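/- Let $K,m,p$ be integers, let regimes take values in $\{1,\dots,K\}$, states $\mathbf x_k$ in $\mathbb R^m$, observations $\mathbf y_k$ in $\mathbb R^p$, and put $\mathbf z_k=(\mathbf x_k,\mathbf y_k)$ (as a block column vector). Write $\mathcal N(\mathbf m;\mathbf P)$ for the Gaussian law with mean $\mathbf m$ and covariance matrix $\mathbf P$, and $\mathbf r_{i:j}=(r_i,\dots,r_j)$. **Physical data.** Fix jump transition probabilities $p^1(r_k|r_{k-1})$ $(k\ge1)$, and for each regime $r$ matrices $\mathbf P_0(r)$, $\mathbf F_k(r)$, $\mathbf Q_k(r)$ $(k\ge 1)$ and $\mathbf H_k(r)$, $\mathbf R_k(r)$ $(k\ge 0)$, where all covariance matrices $\mathbf P_0(r),\mathbf Q_k(r),\mathbf R_k(r)$ are symmetric positive definite and every $\mathbf F_k(r)$ is invertible. For prior means $\mathbf m_0=(\mathbf m_0(r))_r$ with values in $\mathbb R^m$ put $$p^1(\mathbf x_0|r_0)=\mathcal N(\mathbf m_0(r_0);\mathbf P_0(r_0)),\qquad f_{k|k-1}(\mathbf x_k|\mathbf x_{k-1},r_k)=\mathcal N(\mathbf F_k(r_k)\mathbf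 x_{k-1};\mathbf Q_k(r_k)),\qquad g_k(\mathbf y_k|\mathbf x_k,r_k)=\mathcal N(\mathbf H_k(r_k)\mathbf x_k;\mathbf R_k(r_k)).$$ **Models.** A linear and Gaussian conditional pairwise Markov chain (PMC) model is a law of $(\mathbf z_k,r_k)_{k\ge0}$ given by $$p^2(\mathbf z_{0:k},\mathbf r_{0:k})=p^2(r_0)\,p^2(\mathbf z_0|r_0)\prod_{i=1}^k p^2(r_i|r_{i-1})\,p^2_{i|i-1}(\mathbf z_i|\mathbf z_{i-1},\mathbf r_{i-1:i}),\qquad p^2_{i|i-1}(\mathbf z_i|\mathbf z_{i-1},\mathbf r_{i-1:i})=\mathcal N(\mathbf B_i(\mathbf r_{i-1:i})\mathbf z_{i-1};\mathbf\Sigma_i(\mathbf r_{i-1:i})),$$ with $\mathbf\Sigma_i(\mathbf r_{i-1:i})$ positive definite. We consider such models for all prior means $\mathbf m_0$ at once: $p^2(\mathbf z_0|r_0)$ may depend on $\mathbf m_0$, while $p^2(r_0)$, $p^2(r_i|r_{i-1})$, $\mathbf B_i$ and $\mathbf\Sigma_i$ do not depend on $\mathbf m_0$. **Statement.** Such a family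 of models satisfies, for every $\mathbf m_0$, $$p^2(\mathbf x_0|r_0)=p^1(\mathbf x_0|r_0),\qquad p^2(r_k|r_{k-1})=p^1(r_k|r_{k-1})\ (k\ge1),$$ $$p^2(\mathbf x_k|\mathbf x_{k-1},\mathbf r_{0:k})=f_{k|k-1}(\mathbf x_k|\mathbf x_{k-1},r_k)\ (k\ge1),\qquad p^2(\mathbf y_k|\mathbf x_k,\mathbf r_{0:k})=g_k(\mathbf y_k|\mathbf x_k,r_k)\ (k\ge0)$$ (equalities of conditional laws) if and only if the following three conditions hold: 1. $p^2(r_k|r_{k-1})=p^1(r_k|r_{k-1})$ for all $k\ge1$ and all $r_{k-1}$ of positive $p^2$-probability; 2. $p^2(\mathbf z_0|r_0)=p^1(\mathbf x_0|r_0)\,g_0(\mathbf y_0|\mathbf x_0,r_0)$ for every $\mathbf m_0$ and all $r_0$ with $p^2(r_0)>0$; 3. there are matrices $\mathbf F^2_k(\mathbf r_{k-1:k})\in\mathbb R^{m\times p}$ and $\mathbf H^2_k(\mathbf r_{k-1:k})\in\mathbb R^{p\times p}$ $(k\ge1)$ for which the matrices $\mathbf\Sigma_k(\mathbf r_{k-1:k})$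 displayed below are positive definite for all $k$ and all $\mathbf r_{k-1:k}$, such that for all $k\ge 1$ and all $\mathbf r_{k-1:k}$ of positive $p^2$-probability the model's transition is $\mathcal N(\mathbf B_k(\mathbf r_{k-1:k})\mathbf z_{k-1};\mathbf\Sigma_k(\mathbf r_{k-1:k}))$ with $$\mathbf B_k(\mathbf r_{k-1:k})=\begin{bmatrix}\mathbf F_k(r_k)-\mathbf F^2_k(\mathbf r_{k-1:k})\mathbf H_{k-1}(r_{k-1})&\mathbf F^2_k(\mathbf r_{k-1:k})\\ \mathbf H_k(r_k)\mathbf F_k(r_k)-\mathbf H^2_k(\mathbf r_{k-1:k})\mathbf H_{k-1}(r_{k-1})&\mathbf H^2_k(\mathbf r_{k-1:k})\end{bmatrix},\qquad \mathbf\Sigma_k=\begin{bmatrix}\mathbf\Sigma_k^{11}&(\mathbf\Sigma_k^{21})^T\\ \mathbf\Sigma_k^{21}&\mathbf\Sigma_k^{22}\end{bmatrix},$$ $$\mathbf\Sigma^{11}_k(\mathbf r_{k-1:k})=\mathbf Q_k(r_k)-\mathbf F^2_k(\mathbf r_{k-1:k})\mathbf R_{k-1}(r_{k-1})\mathbf F^2_k(\mathbf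 r_{k-1:k})^T,$$ $$\mathbf\Sigma^{21}_k(\mathbf r_{k-1:k})=\mathbf H_k(r_k)\mathbf Q_k(r_k)-\mathbf H^2_k(\mathbf r_{k-1:k})\mathbf R_{k-1}(r_{k-1})\mathbf F^2_k(\mathbf r_{k-1:k})^T,$$ $$\mathbf\Sigma^{22}_k(\mathbf r_{k-1:k})=\mathbf R_k(r_k)-\mathbf H^2_k(\mathbf r_{k-1:k})\mathbf R_{k-1}(r_{k-1})\mathbf H^2_k(\mathbf r_{k-1:k})^T+\mathbf H_k(r_k)\mathbf Q_k(r_k)\mathbf H_k(r_k)^T.$$ -/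

import Mathlib

open MeasureTheory ProbabilityTheory

noncomputable section

namespace CondPMC

/-- Euclidean column vectors indexed by `ι`. -/
abbrev Vec (ι : Type) : Type := EuclideanSpace ℝ ι

/-- Values of the pair `z = (x, y)` with `x ∈ ℝᵐ` and `y ∈ ℝᵖ`, as one block column vector. -/
abbrev Pair (m p : ℕ) : Type := Vec (Fin m ⊕ Fin p)

/-- Square block matrices acting on `z = (x, y)`. -/
abbrev PairMatrix (m p : ℕ) : Type := Matrix (Fin m ⊕ Fin p) (Fin m ⊕ Fin p) ℝ

/-- The state component `x` of `z = (x, y)`. -/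
def xPart {m p : ℕ} (z : Pair m p) : Vec (Fin m) := WithLp.toLp 2 fun i => z (Sum.inl i)

/-- The observation component `y` of `z = (x, y)`. -/
def yPart {m p : ℕ} (z : Pair m p) : Vec (Fin p) := WithLp.toLp 2 fun j => z (Sum.inr j)

/-- The block vector `z = (x, y)`. -/
def joinXY {m p : ℕ} (q : Vec (Fin m) × Vec (Fin p)) : Pair m p :=
  WithLp.toLp 2 (Sum.elim q.1 q.2)

section Kernels

variable {ι κ A : Type} [Fintype ι] [Fintype κ] [DecidableEq κ]
  [MeasurableSpace A] [MeasurableSingletonClass A] [Countable A]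

open scoped MatrixOrder in
/-- The conditional Gaussian law `(u, a) ↦ 𝒩(C(a) u ; S(a))`, where `a` is a regime. -/
def gaussKernel (C : A → Matrix κ ι ℝ) (S : A → Matrix κ κ ℝ) :
    Kernel (Vec ι × A) (Vec κ) where
  toFun q := multivariateGaussian (WithLp.toLp 2 ((C q.2).mulVec q.1)) (S q.2)
  measurable' := by
    refine measurable_from_prod_countable_left fun a => ?_
    have hf : Measurable fun q : Vec ι × Vec κ =>
        (WithLp.toLp 2 ((C a).mulVec q.1) : Vec κ)
          + Matrix.toEuclideanCLM (𝕜 := ℝ) (CFC.sqrt (S a)) q.2 := by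
      refine Continuous.measurable ?_
      fun_prop
    refine Measure.measurable_of_measurable_coe _ fun s hs => ?_
    have hm : ∀ u : Vec ι, Measurable fun v : Vec κ =>
        (WithLp.toLp 2 ((C a).mulVec u) : Vec κ)
          + Matrix.toEuclideanCLM (𝕜 := ℝ) (CFC.sqrt (S a)) v := fun u =>
      hf.comp (measurable_const.prodMk measurable_id)
    simp only [multivariateGaussian, Measure.map_apply (hm _) hs]
    exact measurable_measure_prodMk_left (hf hs)

instance (C : A → Matrix κ ι ℝ) (S : A → Matrix κ κ ℝ) : IsMarkovKernel (gaussKernel C S) :=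
  ⟨fun q => by change IsProbabilityMeasure (multivariateGaussian _ _); infer_instance⟩

end Kernels

/-- The Markov kernel on regimes with rows `P r`. -/
def jumpKernel {K : ℕ} (P : Fin K → PMF (Fin K)) : Kernel (Fin K) (Fin K) :=
  Kernel.ofFunOfCountable fun r => (P r).toMeasure

instance {K : ℕ} (P : Fin K → PMF (Fin K)) : IsMarkovKernel (jumpKernel P) :=
  ⟨fun r => by change IsProbabilityMeasure (P r).toMeasure; infer_instance⟩

/-- The physical data with `K` regimes. `jump k` is the transition `p¹(r_k | r_{k-1})`, for `k ≥ 1`;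
`P0` is the covariance of `p¹(x_0 | r_0)`, for every regime `r_0`;
`F k`, `Q k` (for `k ≥ 1`) give `f_{k|k-1}(x_k | x_{k-1}, r_k) = 𝒩(F_k(r_k) x_{k-1} ; Q_k(r_k))`;
`H k`, `R k` (for `k ≥ 0`) give `g_k(y_k | x_k, r_k) = 𝒩(H_k(r_k) x_k ; R_k(r_k))`. -/
structure Physics (m p K : ℕ) where
  jump : ℕ → Fin K → PMF (Fin K)
  P0 : Fin K → Matrix (Fin m) (Fin m) ℝ
  F : ℕ → Fin K → Matrix (Fin m) (Fin m) ℝ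
  Q : ℕ → Fin K → Matrix (Fin m) (Fin m) ℝ
  H : ℕ → Fin K → Matrix (Fin p) (Fin m) ℝ
  R : ℕ → Fin K → Matrix (Fin p) (Fin p) ℝ

/-- The standing assumptions: covariance matrices are positive definite and every `F_k(r)`, `k ≥ 1`,
is invertible. -/
structure Physics.Regular {m p K : ℕ} (φ : Physics m p K) : Prop where
  posDef_P0 : ∀ r, (φ.P0 r).PosDef
  posDef_Q : ∀ k r, (φ.Q (k + 1) r).PosDef
  posDef_R : ∀ k r, (φ.R k r).PosDef
  isUnit_F : ∀ k r, IsUnit (φ.F (k + 1) r)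

/-- `p¹(x_0 | r_0) g_0(y_0 | x_0, r_0)` at `r_0 = r`, when `p¹(x_0 | r_0) = 𝒩(m0(r_0) ; P0(r_0))`. -/
def Physics.initialLaw {m p K : ℕ} (φ : Physics m p K) (m0 : Fin K → Vec (Fin m)) (r : Fin K) :
    Measure (Pair m p) :=
  ((multivariateGaussian (m0 r) (φ.P0 r)) ⊗ₘ
    ((gaussKernel (φ.H 0) (φ.R 0)).comap (fun x => (x, r)) (by fun_prop))).map joinXY

/-- The jump chain and the linear Gaussian transitions of a conditional PMC model.
`jumpInit` is `p²(r_0)`; for `k ≥ 1`, `jump k` is `p²(r_k | r_{k-1})` and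
`p²(z_k | z_{k-1}, r_{k-1:k}) = 𝒩(B_k(r_{k-1}, r_k) z_{k-1} ; S_k(r_{k-1}, r_k))`. -/
structure Dynamics (m p K : ℕ) where
  jumpInit : PMF (Fin K)
  jump : ℕ → Fin K → PMF (Fin K)
  B : ℕ → Fin K → Fin K → PairMatrix m p
  S : ℕ → Fin K → Fin K → PairMatrix m p
  posDef_S : ∀ k r s, (S (k + 1) r s).PosDef

/-- Values of `(r_k, z_k)`. -/
abbrev Obs (m p K : ℕ) : Type := Fin K × Pair m p

namespace Dynamics

variable {m p K : ℕ} (D : Dynamics m p K)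

/-- The conditional law of `(r_k, z_k)` given `(r_{k-1}, z_{k-1})`, that is
`p²(r_k | r_{k-1}) p²(z_k | z_{k-1}, r_{k-1:k})`. -/
def step (k : ℕ) : Kernel (Obs m p K) (Obs m p K) :=
  ((jumpKernel (D.jump k)).comap Prod.fst measurable_fst) ⊗ₖ
    ((gaussKernel (A := Fin K × Fin K) (fun a => D.B k a.1 a.2) (fun a => D.S k a.1 a.2)).comap
      (fun q : Obs m p K × Fin K => (q.1.2, (q.1.1, q.2))) (by fun_prop))

instance (k : ℕ) : IsMarkovKernel (D.step k) := by
  unfold step; infer_instance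

/-- The law of the whole trajectory `(r_k, z_k)_{k ≥ 0}` of the conditional PMC model with these
dynamics and with initial conditional law `p²(z_0 | r_0) = init r_0`. -/
def law (init : Fin K → ProbabilityMeasure (Pair m p)) : Measure (ℕ → Obs m p K) :=
  Kernel.trajMeasure (X := fun _ => Obs m p K)
    (D.jumpInit.toMeasure ⊗ₘ
      Kernel.ofFunOfCountable fun r => (init r : Measure (Pair m p)))
    fun n => (D.step (n + 1)).comap (fun h => h ⟨n, Finset.mem_Iic.2 le_rfl⟩) (by fun_prop)

/-- The marginal law `p²(r_k)`. -/
def jumpLaw : ℕ → PMF (Fin K)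
  | 0 => D.jumpInit
  | k + 1 => (jumpLaw k).bind (D.jump (k + 1))

end Dynamics

section Coordinates

variable {m p K : ℕ}

/-- The regime `r_k` along a trajectory. -/
def rAt (k : ℕ) (ω : ℕ → Obs m p K) : Fin K := (ω k).1

/-- The state `x_k` along a trajectory. -/
def xAt (k : ℕ) (ω : ℕ → Obs m p K) : Vec (Fin m) := xPart (ω k).2

/-- The observation `y_k` along a trajectory. -/
def yAt (k : ℕ) (ω : ℕ → Obs m p K) : Vec (Fin p) := yPart (ω k).2

/-- The regimes `r_{0:k}` along a trajectory. -/
def rUpTo (k : ℕ) (ω : ℕ → Obs m p K) : Finset.Iic k → Fin K := fun i => rAt i ω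

end Coordinates

/-- A kernel depending on `r_k` seen as a kernel depending on `r_{0:k}`. -/
def givenPath {ι κ : Type} {K : ℕ} (k : ℕ) (η : Kernel (Vec ι × Fin K) (Vec κ)) :
    Kernel (Vec ι × (Finset.Iic k → Fin K)) (Vec κ) :=
  η.comap (fun q => (q.1, q.2 ⟨k, Finset.mem_Iic.2 le_rfl⟩)) (by fun_prop)

/-- The law `μ` of `(r_k, z_k)_{k ≥ 0}` has the physical properties `φ` with prior means `m0`. -/
structure HasPhysics {m p K : ℕ} (φ : Physics m p K) (m0 : Fin K → Vec (Fin m))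
    (μ : Measure (ℕ → Obs m p K)) : Prop where
  /-- `p²(x_0 | r_0) = 𝒩(m0(r_0) ; P0(r_0))` -/
  initial : HasCondDistrib (xAt 0) (rAt 0)
    (Kernel.ofFunOfCountable fun r => multivariateGaussian (m0 r) (φ.P0 r)) μ
  /-- `p²(r_k | r_{k-1}) = p¹(r_k | r_{k-1})` for `k ≥ 1` -/
  jump : ∀ k, HasCondDistrib (rAt (k + 1)) (rAt k) (jumpKernel (φ.jump (k + 1))) μ
  /-- `p²(x_k | x_{k-1}, r_{0:k}) = f_{k|k-1}(x_k | x_{k-1}, r_k)` for `k ≥ 1` -/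
  state : ∀ k, HasCondDistrib (xAt (k + 1)) (fun ω => (xAt k ω, rUpTo (k + 1) ω))
    (givenPath (k + 1) (gaussKernel (φ.F (k + 1)) (φ.Q (k + 1)))) μ
  /-- `p²(y_k | x_k, r_{0:k}) = g_k(y_k | x_k, r_k)` for `k ≥ 0` -/
  likelihood : ∀ k, HasCondDistrib (yAt k) (fun ω => (xAt k ω, rUpTo k ω))
    (givenPath k (gaussKernel (φ.H k) (φ.R k))) μ

section Matrices

variable {m p K : ℕ} (φ : Physics m p K)
  (F2 : ℕ → Fin K → Fin K → Matrix (Fin m) (Fin p) ℝ)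
  (H2 : ℕ → Fin K → Fin K → Matrix (Fin p) (Fin p) ℝ)

/-- The matrix `B_{k+1}(r, s)`, with `r = r_k` and `s = r_{k+1}`. -/
def Physics.BMat (k : ℕ) (r s : Fin K) : PairMatrix m p :=
  Matrix.fromBlocks
    (φ.F (k + 1) s - F2 (k + 1) r s * φ.H k r) (F2 (k + 1) r s)
    (φ.H (k + 1) s * φ.F (k + 1) s - H2 (k + 1) r s * φ.H k r) (H2 (k + 1) r s)

/-- `Σ¹¹_{k+1}(r, s)` -/
def Physics.Sigma11 (k : ℕ) (r s : Fin K) : Matrix (Fin m) (Fin m) ℝ :=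
  φ.Q (k + 1) s - F2 (k + 1) r s * φ.R k r * (F2 (k + 1) r s).transpose

/-- `Σ²¹_{k+1}(r, s)` -/
def Physics.Sigma21 (k : ℕ) (r s : Fin K) : Matrix (Fin p) (Fin m) ℝ :=
  φ.H (k + 1) s * φ.Q (k + 1) s - H2 (k + 1) r s * φ.R k r * (F2 (k + 1) r s).transpose

/-- `Σ²²_{k+1}(r, s)` -/
def Physics.Sigma22 (k : ℕ) (r s : Fin K) : Matrix (Fin p) (Fin p) ℝ :=
  φ.R (k + 1) s - H2 (k + 1) r s * φ.R k r * (H2 (k + 1) r s).transpose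
    + φ.H (k + 1) s * φ.Q (k + 1) s * (φ.H (k + 1) s).transpose

/-- The matrix `Σ_{k+1}(r, s)`, with `r = r_k` and `s = r_{k+1}`. -/
def Physics.SigmaMat (k : ℕ) (r s : Fin K) : PairMatrix m p :=
  Matrix.fromBlocks
    (φ.Sigma11 F2 k r s) (φ.Sigma21 F2 H2 k r s).transpose
    (φ.Sigma21 F2 H2 k r s) (φ.Sigma22 H2 k r s)

end Matrices

end CondPMC

end

/-! Regimes are discrete, so conditioning on `r_{0:k}` means working on each fibre `{r_{0:k} = ρ}`
with the restricted, unnormalised law; null fibres then cost nothing. On a fibre the pair is moved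
by the linear Gaussian kernel `(B, S)`, weighted by a jump probability (`law_fiber_succ`), and the
likelihood property says that `z_k` has the law `obsLaw ν H R` of `(x, Hx + v)` with `x ∼ ν` and
independent noise `v ∼ 𝒩(0 ; R)`.

Everything rests on two matrix identities: `B [1; H] = [1; H'] F`, and `G R Gᵀ + S = jointCov Q H'
R'` with `G = B [0; 1]`. The first says that the mean of `z` given the previous `x` is the physical
one. The second says that the previous observation noise, fed through `G`, and the fresh noise `S`
together make up the physical covariance of `(x, y)` given the previous state. Splitting `G` into
its blocks `F²` and `H²` turns these identities into the displayed `B` and `Σ` (`matrices_eq_iff`).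

Sufficiency: under the identities the kernel sends `obsLaw δ_x` to `obsLaw (𝒩(F x ; Q))` for each
`x`. Integrating over `x` gives the state transition, and induction on time gives the likelihood.

Necessity: along some path to each reachable regime, `x_k` is Gaussian with mean `M m0(r_0)`, where
`M` is a product of the `F_i`, hence invertible (`exists_path_gaussian`). Varying `m0` makes this
mean arbitrary, and equating means and covariances of the two Gaussian expressions for the law of
`z_{k+1}` yields the identities (`matrices_of_linGauss_comp_obsLaw`). -/

noncomputable section

namespace CondPMC

/-- The linear Gaussian kernel `u ↦ 𝒩(C u ; S)`. -/
def linGauss {ι κ : Type} [Fintype ι] [Fintype κ] [DecidableEq κ]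
    (C : Matrix κ ι ℝ) (S : Matrix κ κ ℝ) : Kernel (Vec ι) (Vec κ) :=
  (gaussKernel (fun _ : Unit => C) (fun _ => S)).comap (fun u => (u, ())) (by fun_prop)

instance {ι κ : Type} [Fintype ι] [Fintype κ] [DecidableEq κ]
    (C : Matrix κ ι ℝ) (S : Matrix κ κ ℝ) : IsMarkovKernel (linGauss C S) := by
  unfold linGauss; infer_instance

lemma linGauss_apply {ι κ : Type} [Fintype ι] [Fintype κ] [DecidableEq κ]
    (C : Matrix κ ι ℝ) (S : Matrix κ κ ℝ) (u : Vec ι) :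
    linGauss C S u = multivariateGaussian (WithLp.toLp 2 (C.mulVec u)) S := rfl

/-! ### Conditioning on discrete variables, fibre by fibre -/

section Slices

variable {Ω A U V : Type*} [MeasurableSpace Ω] [MeasurableSpace A] [MeasurableSingletonClass A]
  [MeasurableSpace U] [MeasurableSpace V] {μ : Measure Ω}

lemma setLIntegral_fiber {a : Ω → A} (ha : Measurable a) (a0 : A) (f : A → Ω → ENNReal) :
    ∫⁻ ω in a ⁻¹' {a0}, f (a ω) ω ∂μ = ∫⁻ ω in a ⁻¹' {a0}, f a0 ω ∂μ := by
  refine setLIntegral_congr_fun (ha (measurableSet_singleton a0)) fun ω hω => ?_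
  have : a ω = a0 := hω
  simp only [this]

lemma lintegral_eq_tsum_fiber [Countable A] {a : Ω → A} (ha : Measurable a) (f : Ω → ENNReal) :
    ∫⁻ ω, f ω ∂μ = ∑' a0, ∫⁻ ω in a ⁻¹' {a0}, f ω ∂μ := by
  rw [← lintegral_iUnion (fun a0 => ha (measurableSet_singleton a0)), ← Set.preimage_iUnion,
    Set.iUnion_of_singleton, Set.preimage_univ, Measure.restrict_univ]
  intro i j hij
  exact Disjoint.preimage _ (by simpa using hij)

/-- Conditioning on a pair whose second component is discrete is conditioning on the first
component over every fibre of the second one. -/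
lemma hasCondDistrib_prod_iff [Countable A] [SFinite μ] {X : Ω → U} {a : Ω → A} {Y : Ω → V}
    (hX : Measurable X) (ha : Measurable a) (hY : Measurable Y)
    (κ : Kernel (U × A) V) [IsMarkovKernel κ] :
    HasCondDistrib Y (fun ω => (X ω, a ω)) κ μ ↔
      ∀ a0, (μ.restrict (a ⁻¹' {a0})).map (fun ω => (X ω, Y ω)) =
        (μ.restrict (a ⁻¹' {a0})).map X ⊗ₘ κ.comap (fun u => (u, a0)) (by fun_prop) := by
  constructor
  · intro h a0
    refine Measure.ext_of_lintegral _ fun f hf => ?_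
    rw [lintegral_map hf (by fun_prop), Measure.lintegral_compProd hf,
      lintegral_map (by
        exact Measurable.lintegral_kernel_prod_right' (κ := κ.comap (fun u => (u, a0)) (by fun_prop)) hf) hX]
    have hm : MeasurableSet (a ⁻¹' {a0}) := ha (measurableSet_singleton a0)
    set S : Set ((U × A) × V) := (fun q => q.1.2) ⁻¹' {a0}
    have hS : MeasurableSet S := by
      apply measurableSet_preimage (by fun_prop) (measurableSet_singleton a0)
    -- Cutting the test function down to the slice `a = a0` makes the global identity test the
    -- identity on that fibre.
    set G : (U × A) × V → ENNReal := S.indicator fun q => f (q.1.1, q.2)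
    have hG : Measurable G := Measurable.indicator (by fun_prop) hS
    have h1 : ∫⁻ q, G q ∂(μ.map (fun ω => ((X ω, a ω), Y ω)))
        = ∫⁻ q, G q ∂((μ.map fun ω => (X ω, a ω)) ⊗ₘ κ) := by rw [h.map_eq]
    rw [lintegral_map hG (by fun_prop), Measure.lintegral_compProd hG,
      lintegral_map (by exact Measurable.lintegral_kernel_prod_right' hG) (by fun_prop)] at h1
    rw [← lintegral_indicator hm, ← lintegral_indicator hm]
    refine Eq.trans (lintegral_congr fun ω => ?_) (h1.trans (lintegral_congr fun ω => ?_))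
    · by_cases hω : a ω = a0 <;> simp [G, S, hω]
    · by_cases hω : a ω = a0 <;> simp [G, S, hω]
  · intro h
    refine ⟨by fun_prop, ?_⟩
    refine Measure.ext_of_lintegral _ fun f hf => ?_
    rw [lintegral_map hf (by fun_prop), Measure.lintegral_compProd hf,
      lintegral_map (by exact Measurable.lintegral_kernel_prod_right' hf) (by fun_prop),
      lintegral_eq_tsum_fiber ha, lintegral_eq_tsum_fiber ha]
    congr 1
    ext a0
    rw [setLIntegral_fiber ha a0 (fun b ω => f ((X ω, b), Y ω)),
      setLIntegral_fiber ha a0 (fun b ω => ∫⁻ y, f ((X ω, b), y) ∂κ (X ω, b))]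
    have hf' : Measurable fun q : U × V => f ((q.1, a0), q.2) := by fun_prop
    have h1 : ∫⁻ q, f ((q.1, a0), q.2) ∂((μ.restrict (a ⁻¹' {a0})).map fun ω => (X ω, Y ω)) = _ :=
      congrArg (fun ν => ∫⁻ q, f ((q.1, a0), q.2) ∂ν) (h a0)
    rw [lintegral_map hf' (by fun_prop), Measure.lintegral_compProd hf',
      lintegral_map (by exact Measurable.lintegral_kernel_prod_right' (κ := κ.comap (fun u => (u, a0)) (by fun_prop)) hf') hX] at h1
    exact h1

/-- Conditioning on a discrete random variable. -/
lemma hasCondDistrib_discrete_iff [Countable A] [SFinite μ] {a : Ω → A} {Y : Ω → V}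
    (ha : Measurable a) (hY : Measurable Y) (κ : Kernel A V) [IsMarkovKernel κ] :
    HasCondDistrib Y a κ μ ↔
      ∀ a0, (μ.restrict (a ⁻¹' {a0})).map Y = μ (a ⁻¹' {a0}) • κ a0 := by
  constructor
  · intro h a0
    ext s hs
    have h1 := congrArg (fun ν => ν ({a0} ×ˢ s)) h.map_eq
    beta_reduce at h1
    rw [Measure.map_apply (by fun_prop) ((measurableSet_singleton a0).prod hs),
      Measure.compProd_apply_prod (measurableSet_singleton a0) hs, lintegral_singleton,
      Measure.map_apply ha (measurableSet_singleton a0)] at h1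
    rw [Measure.map_apply hY hs, Measure.restrict_apply (hY hs), Measure.smul_apply, smul_eq_mul,
      mul_comm, ← h1]
    congr 1
    ext ω
    simp [and_comm]
  · intro h
    refine ⟨by fun_prop, ?_⟩
    refine Measure.ext_of_lintegral _ fun f hf => ?_
    rw [lintegral_map hf (by fun_prop), Measure.lintegral_compProd hf,
      lintegral_map (by exact Measurable.lintegral_kernel_prod_right' hf) (by fun_prop),
      lintegral_eq_tsum_fiber ha, lintegral_eq_tsum_fiber ha]
    congr 1
    ext a0
    rw [setLIntegral_fiber ha a0 (fun b ω => f (b, Y ω)),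
      setLIntegral_fiber ha a0 (fun b ω => ∫⁻ y, f (b, y) ∂κ b)]
    have h1 : ∫⁻ y, f (a0, y) ∂((μ.restrict (a ⁻¹' {a0})).map Y) = _ :=
      congrArg (fun ν => ∫⁻ y, f (a0, y) ∂ν) (h a0)
    rw [lintegral_map (by fun_prop) hY, lintegral_smul_measure] at h1
    rw [h1, lintegral_const, Measure.restrict_apply_univ, smul_eq_mul, mul_comm]

end Slices

/-! ### The trajectory law along a path of regimes -/

section Law

variable {m p K : ℕ} (D : Dynamics m p K) (init : Fin K → ProbabilityMeasure (Pair m p))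

@[fun_prop] lemma measurable_xPart : Measurable (xPart : Pair m p → Vec (Fin m)) := by
  unfold xPart; fun_prop

@[fun_prop] lemma measurable_yPart : Measurable (yPart : Pair m p → Vec (Fin p)) := by
  unfold yPart; fun_prop

@[fun_prop] lemma measurable_joinXY :
    Measurable (joinXY : Vec (Fin m) × Vec (Fin p) → Pair m p) := by
  have : Continuous (joinXY : Vec (Fin m) × Vec (Fin p) → Pair m p) := by
    unfold joinXY
    refine (PiLp.continuous_toLp 2 _).comp (continuous_pi fun i => ?_)
    rcases i with i | i <;> simp <;> fun_prop
  exact this.measurable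

/-- The pair `z_k` along a trajectory. -/
def zAt (k : ℕ) (ω : ℕ → Obs m p K) : Pair m p := (ω k).2

@[fun_prop] lemma measurable_zAt (k : ℕ) : Measurable (zAt (m := m) (p := p) (K := K) k) := by
  unfold zAt; fun_prop

@[fun_prop] lemma measurable_xAt (k : ℕ) : Measurable (xAt (m := m) (p := p) (K := K) k) := by
  unfold xAt; fun_prop

@[fun_prop] lemma measurable_yAt (k : ℕ) : Measurable (yAt (m := m) (p := p) (K := K) k) := by
  unfold yAt; fun_prop

@[fun_prop] lemma measurable_rAt (k : ℕ) : Measurable (rAt (m := m) (p := p) (K := K) k) := by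
  unfold rAt; fun_prop

@[fun_prop] lemma measurable_rUpTo (k : ℕ) : Measurable (rUpTo (m := m) (p := p) (K := K) k) := by
  unfold rUpTo; fun_prop

instance : IsProbabilityMeasure (D.law init) := by
  have : IsMarkovKernel (Kernel.ofFunOfCountable fun r => (init r : Measure (Pair m p))) :=
    ⟨fun r => by change IsProbabilityMeasure (init r : Measure (Pair m p)); infer_instance⟩
  unfold Dynamics.law
  infer_instance

lemma lintegral_step (k : ℕ) (q : Obs m p K) {g : Obs m p K → ENNReal} (hg : Measurable g) :
    ∫⁻ q', g q' ∂(D.step k q) = ∑ s, D.jump k q.1 s *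
      ∫⁻ z, g (s, z) ∂(linGauss (D.B k q.1 s) (D.S k q.1 s) q.2) := by
  unfold Dynamics.step
  rw [Kernel.lintegral_compProd _ _ _ hg, lintegral_fintype]
  refine Finset.sum_congr rfl fun s _ => ?_
  rw [mul_comm]
  congr 1
  change (D.jump k q.1).toMeasure {s} = _
  rw [PMF.toMeasure_apply_singleton _ _ (measurableSet_singleton s)]

/-- The Markov property of the trajectory measure, tested on functions. `G` sees the entire past, so
that indicators of regime paths are admissible. -/
lemma lintegral_law_succ (n : ℕ) {G : (Finset.Iic n → Obs m p K) × Obs m p K → ENNReal}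
    (hG : Measurable G) :
    ∫⁻ ω, G (fun i => ω i, ω (n + 1)) ∂(D.law init) =
      ∫⁻ ω, ∑ s, D.jump (n + 1) (rAt n ω) s *
        ∫⁻ z, G (fun i => ω i, (s, z))
          ∂(linGauss (D.B (n + 1) (rAt n ω) s) (D.S (n + 1) (rAt n ω) s) (zAt n ω))
        ∂(D.law init) := by
  have : IsMarkovKernel (Kernel.ofFunOfCountable fun r => (init r : Measure (Pair m p))) :=
    ⟨fun r => by change IsProbabilityMeasure (init r : Measure (Pair m p)); infer_instance⟩
  have h := Kernel.map_frestrictLe_trajMeasure_compProd_eq_map_trajMeasure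
    (X := fun _ => Obs m p K)
    (μ₀ := D.jumpInit.toMeasure ⊗ₘ
      Kernel.ofFunOfCountable fun r => (init r : Measure (Pair m p)))
    (κ := fun n => (D.step (n + 1)).comap (fun h => h ⟨n, Finset.mem_Iic.2 le_rfl⟩) (by fun_prop))
    (a := n)
  change (D.law init).map _ ⊗ₘ _ = (D.law init).map _ at h
  have h1 := congrArg (fun ν => ∫⁻ q, G q ∂ν) h
  beta_reduce at h1
  rw [Measure.lintegral_compProd hG,
    lintegral_map (by
      exact Measurable.lintegral_kernel_prod_right' (κ := (D.step (n + 1)).comap (fun h : Finset.Iic n → Obs m p K =>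
        h ⟨n, Finset.mem_Iic.2 le_rfl⟩) (by fun_prop)) hG) (by fun_prop),
    lintegral_map hG (by fun_prop)] at h1
  refine h1.symm.trans (lintegral_congr fun ω => ?_)
  rw [Kernel.comap_apply, lintegral_step _ _ _ (by fun_prop)]
  rfl

lemma law_map_zero : (D.law init).map (fun ω => ω 0) =
    D.jumpInit.toMeasure ⊗ₘ Kernel.ofFunOfCountable fun r => (init r : Measure (Pair m p)) := by
  have : IsMarkovKernel (Kernel.ofFunOfCountable fun r => (init r : Measure (Pair m p))) :=
    ⟨fun r => by change IsProbabilityMeasure (init r : Measure (Pair m p)); infer_instance⟩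
  have h : (D.law init).map (Preorder.frestrictLe 0) = (D.jumpInit.toMeasure ⊗ₘ
      Kernel.ofFunOfCountable fun r => (init r : Measure (Pair m p))).map
        (MeasurableEquiv.piUnique fun _ : Finset.Iic 0 => Obs m p K).symm := by
    unfold Dynamics.law Kernel.trajMeasure
    -- Up to time 0 the trajectory kernel is the identity, so only the initial law remains.
    rw [Measure.map_comp _ _ (by fun_prop), Kernel.traj_map_frestrictLe,
      Kernel.partialTraj_self, Measure.id_comp]
  have h2 : (fun ω : ℕ → Obs m p K => ω 0) =
      (fun h : Finset.Iic 0 → Obs m p K => h ⟨0, Finset.mem_Iic.2 le_rfl⟩) ∘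
        Preorder.frestrictLe (π := fun _ => Obs m p K) 0 := rfl
  rw [h2, ← Measure.map_map (by fun_prop) (by fun_prop), h, Measure.map_map (by fun_prop) (by fun_prop)]
  convert Measure.map_id
  exact funext fun q => rfl

lemma law_fiber_zAt_zero (r : Fin K) :
    ((D.law init).restrict (rAt 0 ⁻¹' {r})).map (zAt 0) =
      D.jumpInit r • (init r : Measure (Pair m p)) := by
  have : IsMarkovKernel (Kernel.ofFunOfCountable fun r => (init r : Measure (Pair m p))) :=
    ⟨fun r => by change IsProbabilityMeasure (init r : Measure (Pair m p)); infer_instance⟩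
  ext s hs
  have h1 := congrArg (fun ν => ν ({r} ×ˢ s)) (law_map_zero D init)
  beta_reduce at h1
  rw [Measure.map_apply (by fun_prop) ((measurableSet_singleton r).prod hs),
    Measure.compProd_apply_prod (measurableSet_singleton r) hs, lintegral_singleton,
    PMF.toMeasure_apply_singleton _ _ (measurableSet_singleton r)] at h1
  rw [Measure.map_apply (by fun_prop) hs, Measure.restrict_apply (measurable_zAt 0 hs),
    Measure.smul_apply, smul_eq_mul, mul_comm]
  refine Eq.trans ?_ h1
  congr 1
  ext ω
  simp [zAt, rAt, and_comm]

/-- The path `r_{0:n}` of a path `r_{0:n+1}`. -/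
def pathInit {n : ℕ} (ρ : Finset.Iic (n + 1) → Fin K) : Finset.Iic n → Fin K :=
  fun i => ρ ⟨i, Finset.mem_Iic.2 ((Finset.mem_Iic.1 i.2).trans n.le_succ)⟩

/-- The last regime of a path `r_{0:n}`. -/
def pathLast {n : ℕ} (ρ : Finset.Iic n → Fin K) : Fin K := ρ ⟨n, Finset.mem_Iic.2 le_rfl⟩

/-- The path `r_{0:n+1}` made of `r_{0:n}` and `r_{n+1}`. -/
def pathSnoc {n : ℕ} (ρ : Finset.Iic n → Fin K) (s : Fin K) : Finset.Iic (n + 1) → Fin K :=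
  fun i => if h : (i : ℕ) ≤ n then ρ ⟨i, Finset.mem_Iic.2 h⟩ else s

lemma pathInit_pathSnoc {n : ℕ} (ρ : Finset.Iic n → Fin K) (s : Fin K) :
    pathInit (pathSnoc ρ s) = ρ := by
  ext i
  simp [pathInit, pathSnoc, Finset.mem_Iic.1 i.2]

lemma pathLast_pathSnoc {n : ℕ} (ρ : Finset.Iic n → Fin K) (s : Fin K) :
    pathLast (pathSnoc ρ s) = s := by
  simp [pathLast, pathSnoc]

lemma rUpTo_succ_eq_iff {n : ℕ} (ρ : Finset.Iic (n + 1) → Fin K) (ω : ℕ → Obs m p K) :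
    rUpTo (n + 1) ω = ρ ↔ rUpTo n ω = pathInit ρ ∧ rAt (n + 1) ω = pathLast ρ := by
  constructor
  · rintro rfl
    exact ⟨rfl, rfl⟩
  · rintro ⟨h1, h2⟩
    ext ⟨i, hi⟩
    rcases (Finset.mem_Iic.1 hi).lt_or_eq with h | rfl
    · have := congrFun h1 ⟨i, Finset.mem_Iic.2 (Nat.lt_succ_iff.1 h)⟩
      exact congrArg Fin.val this
    · exact congrArg Fin.val h2

lemma rUpTo_zero_preimage (ρ : Finset.Iic 0 → Fin K) :
    rUpTo (m := m) (p := p) 0 ⁻¹' {ρ} = rAt 0 ⁻¹' {pathLast ρ} := by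
  ext ω
  constructor
  · rintro rfl
    rfl
  · intro h
    ext ⟨i, hi⟩
    obtain rfl : i = 0 := by simpa using hi
    exact congrArg Fin.val h

/-- Along a fixed path of regimes, `(z_n, z_{n+1})` moves by the linear Gaussian transition. -/
lemma law_fiber_succ (n : ℕ) (ρ : Finset.Iic (n + 1) → Fin K) :
    ((D.law init).restrict (rUpTo (n + 1) ⁻¹' {ρ})).map (fun ω => (zAt n ω, zAt (n + 1) ω)) =
      D.jump (n + 1) (pathLast (pathInit ρ)) (pathLast ρ) •
        (((D.law init).restrict (rUpTo n ⁻¹' {pathInit ρ})).map (zAt n) ⊗ₘ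
          linGauss (D.B (n + 1) (pathLast (pathInit ρ)) (pathLast ρ))
            (D.S (n + 1) (pathLast (pathInit ρ)) (pathLast ρ))) := by
  refine Measure.ext_of_lintegral _ fun f hf => ?_
  set r := pathLast (pathInit ρ)
  set s := pathLast ρ
  rw [lintegral_map hf (by fun_prop), lintegral_smul_measure, Measure.lintegral_compProd hf,
    lintegral_map (by exact Measurable.lintegral_kernel_prod_right' hf) (by fun_prop)]
  have hm : MeasurableSet (rUpTo (m := m) (p := p) (n + 1) ⁻¹' {ρ}) :=
    measurable_rUpTo _ (measurableSet_singleton ρ)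
  have hm' : MeasurableSet (rUpTo (m := m) (p := p) n ⁻¹' {pathInit ρ}) :=
    measurable_rUpTo _ (measurableSet_singleton _)
  rw [← lintegral_indicator hm, ← lintegral_indicator hm']
  let T : Set ((Finset.Iic n → Obs m p K) × Obs m p K) :=
    (fun q => ((fun i => (q.1 i).1), q.2.1)) ⁻¹' {(pathInit ρ, s)}
  have hT : MeasurableSet T :=
    measurableSet_preimage (by fun_prop) (measurableSet_singleton _)
  -- The indicator of `T` selects the path `ρ`; in the sum over the next regime only the term `s`
  -- survives.
  let G : (Finset.Iic n → Obs m p K) × Obs m p K → ENNReal :=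
    T.indicator fun q => f ((q.1 ⟨n, Finset.mem_Iic.2 le_rfl⟩).2, q.2.2)
  have hG : Measurable G := Measurable.indicator (by fun_prop) hT
  have h := lintegral_law_succ D init n hG
  have hl : ∀ ω : ℕ → Obs m p K, G (fun i => ω i, ω (n + 1)) =
      (rUpTo (n + 1) ⁻¹' {ρ}).indicator (fun ω => f (zAt n ω, zAt (n + 1) ω)) ω := by
    intro ω
    have : ((fun i : Finset.Iic n => ω i, ω (n + 1)) : (Finset.Iic n → Obs m p K) × Obs m p K) ∈ T ↔
        ω ∈ rUpTo (n + 1) ⁻¹' {ρ} := by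
      simp only [T, Set.mem_preimage, Set.mem_singleton_iff, rUpTo_succ_eq_iff, Prod.mk.injEq]
      rfl
    by_cases hω : ω ∈ rUpTo (n + 1) ⁻¹' {ρ}
    · rw [Set.indicator_of_mem hω]
      exact Set.indicator_of_mem (this.2 hω) _
    · rw [Set.indicator_of_notMem hω]
      exact Set.indicator_of_notMem (fun h => hω (this.1 h)) _
  simp only [hl] at h
  rw [h, smul_eq_mul, ← lintegral_const_mul _ (by
    refine Measurable.indicator ?_ hm'
    exact (Measurable.lintegral_kernel_prod_right' hf).comp (measurable_zAt n))]
  refine lintegral_congr fun ω => ?_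
  by_cases hω : rUpTo n ω = pathInit ρ
  · have hr : rAt n ω = r := congrFun hω ⟨n, Finset.mem_Iic.2 le_rfl⟩
    rw [Finset.sum_eq_single s]
    · rw [hr, Set.indicator_of_mem (by exact hω)]
      congr 1
      refine lintegral_congr fun z => ?_
      have : ((fun i : Finset.Iic n => ω i, (s, z)) :
          (Finset.Iic n → Obs m p K) × Obs m p K) ∈ T := by
        simp only [T, Set.mem_preimage, Set.mem_singleton_iff, Prod.mk.injEq, and_true]
        exact hω
      simp only [G, Set.indicator_of_mem this]
      rfl
    · intro s' _ hs'
      have : ∀ z, ((fun i : Finset.Iic n => ω i, (s', z)) :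
          (Finset.Iic n → Obs m p K) × Obs m p K) ∉ T := by
        intro z
        simp [T, hs']
      simp [G, this]
    · simp
  · have : ∀ s' z, ((fun i : Finset.Iic n => ω i, (s', z)) :
        (Finset.Iic n → Obs m p K) × Obs m p K) ∉ T := by
      intro s' z hT'
      simp only [T, Set.mem_preimage, Set.mem_singleton_iff, Prod.mk.injEq] at hT'
      exact hω hT'.1
    rw [Set.indicator_of_notMem (by exact hω)]
    simp [G, this]

lemma law_rAt_succ_inter (n : ℕ) (r s : Fin K) :
    D.law init (rAt n ⁻¹' {r} ∩ rAt (n + 1) ⁻¹' {s}) =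
      D.law init (rAt n ⁻¹' {r}) * D.jump (n + 1) r s := by
  let T : Set ((Finset.Iic n → Obs m p K) × Obs m p K) :=
    (fun q => ((q.1 ⟨n, Finset.mem_Iic.2 le_rfl⟩).1, q.2.1)) ⁻¹' {(r, s)}
  have hT : MeasurableSet T :=
    measurableSet_preimage (by fun_prop) (measurableSet_singleton _)
  have h := lintegral_law_succ D init n (G := T.indicator 1)
    (Measurable.indicator measurable_one hT)
  have hr : MeasurableSet (rAt (m := m) (p := p) n ⁻¹' {r}) :=
    measurable_rAt _ (measurableSet_singleton r)
  have hs : MeasurableSet (rAt (m := m) (p := p) (n + 1) ⁻¹' {s}) :=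
    measurable_rAt _ (measurableSet_singleton s)
  rw [← lintegral_indicator_one (hr.inter hs), ← lintegral_indicator_one hr,
    ← lintegral_mul_const _ (measurable_one.indicator hr)]
  refine Eq.trans (lintegral_congr fun ω => ?_) (h.trans (lintegral_congr fun ω => ?_))
  · have : ((fun i : Finset.Iic n => ω i, ω (n + 1)) :
        (Finset.Iic n → Obs m p K) × Obs m p K) ∈ T ↔ ω ∈ rAt n ⁻¹' {r} ∩ rAt (n + 1) ⁻¹' {s} := by
      simp [T, rAt]
    by_cases hω : ω ∈ rAt n ⁻¹' {r} ∩ rAt (n + 1) ⁻¹' {s}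
    · rw [Set.indicator_of_mem hω, Set.indicator_of_mem (this.2 hω)]
      rfl
    · rw [Set.indicator_of_notMem hω, Set.indicator_of_notMem (fun h => hω (this.1 h))]
  · by_cases hω : rAt n ω = r
    · rw [Finset.sum_eq_single s]
      · have hω' : (ω n).1 = r := hω
        simp [T, hω, hω']
      · intro s' _ hs'
        simp [T, hs']
      · simp
    · have hω' : ¬ (ω n).1 = r := hω
      simp [T, hω, hω']

lemma law_rAt (n : ℕ) (r : Fin K) : D.law init (rAt n ⁻¹' {r}) = D.jumpLaw n r := by
  induction n generalizing r with
  | zero =>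
    have h := congrArg (fun ν => ν Set.univ) (law_fiber_zAt_zero D init r)
    simpa [Measure.map_apply (measurable_zAt 0), Dynamics.jumpLaw] using h
  | succ n ih =>
    have hs : MeasurableSet (rAt (m := m) (p := p) (K := K) (n + 1) ⁻¹' {r}) :=
      measurable_rAt _ (measurableSet_singleton r)
    have h := lintegral_eq_tsum_fiber (μ := D.law init) (measurable_rAt n)
      ((rAt (n + 1) ⁻¹' {r}).indicator 1)
    rw [lintegral_indicator_one hs] at h
    rw [h, Dynamics.jumpLaw, PMF.bind_apply]
    refine tsum_congr fun r' => ?_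
    rw [lintegral_indicator_one hs, Measure.restrict_apply hs, Set.inter_comm,
      law_rAt_succ_inter, ih]

end Law

/-! ### Linear Gaussian kernels through characteristic functions -/

section Gaussian

open Matrix WithLp
open scoped RealInnerProductSpace

variable {ι κ : Type} [Fintype ι] [Fintype κ]

lemma inner_mulVec_comm (C : Matrix κ ι ℝ) (u : Vec ι) (t : Vec κ) :
    ⟪t, (toLp 2 (C *ᵥ u) : Vec κ)⟫ = ⟪u, (toLp 2 (Cᵀ *ᵥ t) : Vec ι)⟫ := by
  simp only [EuclideanSpace.inner_eq_star_dotProduct, star_trivial]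
  rw [dotProduct_comm, dotProduct_mulVec, mulVec_transpose]

lemma dotProduct_congruence_mulVec (C : Matrix κ ι ℝ) (S : Matrix ι ι ℝ) (t : κ → ℝ) :
    t ⬝ᵥ (C * S * Cᵀ) *ᵥ t = (Cᵀ *ᵥ t) ⬝ᵥ S *ᵥ (Cᵀ *ᵥ t) := by
  rw [← mulVec_mulVec, ← mulVec_mulVec, dotProduct_mulVec, mulVec_transpose]

/-- The factored form isolates the dependence on `u` in a pure exponential at frequency `Cᵀ t`, so
integrating over `u` produces a characteristic function again. -/
lemma charFun_linGauss [DecidableEq κ] (C : Matrix κ ι ℝ) {T : Matrix κ κ ℝ} (hT : T.PosSemidef)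
    (u : Vec ι) (t : Vec κ) : charFun (linGauss C T u) t =
      Complex.exp (⟪u, toLp 2 (Cᵀ *ᵥ t)⟫ * Complex.I) * Complex.exp (-(t ⬝ᵥ T *ᵥ t / 2 : ℝ)) := by
  rw [linGauss_apply, charFun_multivariateGaussian hT, ← Complex.exp_add, inner_mulVec_comm]
  congr 1
  push_cast
  ring

lemma charFun_map_compProd {U V W : Type*} [MeasurableSpace U] [MeasurableSpace V]
    [NormedAddCommGroup W] [InnerProductSpace ℝ W] [MeasurableSpace W] [BorelSpace W]
    [SecondCountableTopology W]
    (μ : Measure U) [IsProbabilityMeasure μ] (η : Kernel U V) [IsMarkovKernel η] {f : U × V → W}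
    (hf : Measurable f) (t : W) :
    charFun ((μ ⊗ₘ η).map f) t =
      ∫ u, ∫ v, Complex.exp (⟪f (u, v), t⟫ * Complex.I) ∂(η u) ∂μ := by
  rw [charFun_apply, integral_map hf.aemeasurable
    (Continuous.aestronglyMeasurable (by fun_prop)), Measure.integral_compProd]
  refine Integrable.of_bound (C := 1) (Measurable.aestronglyMeasurable (by fun_prop)) ?_
  exact Filter.Eventually.of_forall fun q => (Complex.norm_exp_ofReal_mul_I _).le

variable [DecidableEq ι] [DecidableEq κ]

lemma linGauss_comp_multivariateGaussian (C : Matrix κ ι ℝ) {S : Matrix ι ι ℝ} {T : Matrix κ κ ℝ}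
    (hS : S.PosSemidef) (hT : T.PosSemidef) (u : Vec ι) :
    linGauss C T ∘ₘ multivariateGaussian u S =
      multivariateGaussian (toLp 2 (C *ᵥ u)) (C * S * Cᵀ + T) := by
  refine Measure.ext_of_charFun (funext fun t => ?_)
  have hS' : (C * S * Cᵀ).PosSemidef := hS.mul_mul_conjTranspose_same C
  rw [← Measure.snd_compProd, Measure.snd, charFun_map_compProd _ _ measurable_snd,
    charFun_multivariateGaussian (hS'.add hT)]
  simp only [← charFun_apply, charFun_linGauss C hT]
  rw [integral_mul_const, ← charFun_apply, charFun_multivariateGaussian hS, ← Complex.exp_add,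
    inner_mulVec_comm, add_mulVec, dotProduct_add, dotProduct_congruence_mulVec, real_inner_comm]
  congr 1
  push_cast
  ring

/-- Mean and covariance are integrals against the law, so no density is needed and degenerate
covariances are allowed. -/
lemma multivariateGaussian_injective {u v : Vec ι} {S T : Matrix ι ι ℝ} (hS : S.PosSemidef)
    (hT : T.PosSemidef) (h : multivariateGaussian u S = multivariateGaussian v T) :
    u = v ∧ S = T := by
  constructor
  · rw [← integral_id_multivariateGaussian (μ := u) (S := S), h, integral_id_multivariateGaussian]
  · ext i j
    rw [← covariance_eval_multivariateGaussian (μ := u) hS, h,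
      covariance_eval_multivariateGaussian hT]

/-- A deterministic state is a degenerate Gaussian; this is why the Gaussian computations assume
only semidefinite covariances. -/
lemma multivariateGaussian_zero_cov (u : Vec ι) : multivariateGaussian u 0 = Measure.dirac u := by
  simp [multivariateGaussian]

end Gaussian

/-! ### Observation laws and the two matrix identities -/

section Joint

open Matrix WithLp
open scoped RealInnerProductSpace

variable {m p : ℕ}

/-- The block column matrix `[1; H]`. -/
def graphMat (H : Matrix (Fin p) (Fin m) ℝ) : Matrix (Fin m ⊕ Fin p) (Fin m) ℝ := fromRows 1 H

/-- The block column matrix `[0; 1]`. -/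
def obsMat (m p : ℕ) : Matrix (Fin m ⊕ Fin p) (Fin p) ℝ := fromRows 0 1

/-- The covariance of `(x, y)` when `x` has covariance `P` and `y = H x + v`, where `v` has
covariance `R`. -/
def jointCov (P : Matrix (Fin m) (Fin m) ℝ) (H : Matrix (Fin p) (Fin m) ℝ)
    (R : Matrix (Fin p) (Fin p) ℝ) : PairMatrix m p :=
  graphMat H * P * (graphMat H)ᵀ + obsMat m p * R * (obsMat m p)ᵀ

lemma posSemidef_jointCov {P : Matrix (Fin m) (Fin m) ℝ} (hP : P.PosSemidef)
    (H : Matrix (Fin p) (Fin m) ℝ) {R : Matrix (Fin p) (Fin p) ℝ} (hR : R.PosSemidef) :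
    (jointCov P H R).PosSemidef :=
  (hP.mul_mul_conjTranspose_same (graphMat H)).add (hR.mul_mul_conjTranspose_same (obsMat m p))

/-- The law of `(x, y)` when `x` has law `ν` and `y` has conditional law `𝒩(H x ; R)`. -/
def obsLaw (ν : Measure (Vec (Fin m))) (H : Matrix (Fin p) (Fin m) ℝ)
    (R : Matrix (Fin p) (Fin p) ℝ) : Measure (Pair m p) :=
  (ν ⊗ₘ linGauss H R).map joinXY

instance (ν : Measure (Vec (Fin m))) [IsProbabilityMeasure ν] (H : Matrix (Fin p) (Fin m) ℝ)
    (R : Matrix (Fin p) (Fin p) ℝ) : IsProbabilityMeasure (obsLaw ν H R) :=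
  Measure.isProbabilityMeasure_map (by fun_prop)

/-- Integrating out `y` at frequency `t` leaves the factor of `R` and shifts the frequency of `x`
from `xPart t` to `xPart t + Hᵀ yPart t`, which is `[1; H]ᵀ t`. -/
lemma obsLaw_multivariateGaussian (u : Vec (Fin m)) {P : Matrix (Fin m) (Fin m) ℝ}
    (hP : P.PosSemidef) (H : Matrix (Fin p) (Fin m) ℝ) {R : Matrix (Fin p) (Fin p) ℝ}
    (hR : R.PosSemidef) :
    obsLaw (multivariateGaussian u P) H R =
      multivariateGaussian (toLp 2 (graphMat H *ᵥ u)) (jointCov P H R) := by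
  refine Measure.ext_of_charFun (funext fun t => ?_)
  have h1 : ∀ x y, ⟪joinXY (x, y), t⟫ = ⟪x, xPart t⟫ + ⟪y, yPart t⟫ := by
    intro x y
    simp [PiLp.inner_apply, joinXY, xPart, yPart, Fintype.sum_sum_type]
  have h2 : (toLp 2 ((graphMat H)ᵀ *ᵥ t) : Vec (Fin m)) =
      xPart t + toLp 2 (Hᵀ *ᵥ (yPart t).ofLp) := by
    ext i
    simp [graphMat, mulVec, dotProduct, Fintype.sum_sum_type, xPart, yPart,
      one_apply]
  have h3 : (obsMat m p)ᵀ *ᵥ t = (yPart t).ofLp := by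
    ext i
    simp [obsMat, mulVec, dotProduct, Fintype.sum_sum_type, yPart, one_apply]
  rw [obsLaw, charFun_map_compProd _ _ measurable_joinXY,
    charFun_multivariateGaussian (posSemidef_jointCov hP H hR)]
  have h4 : ∀ x, ∫ y, Complex.exp (⟪joinXY (x, y), t⟫ * Complex.I) ∂(linGauss H R x) =
      Complex.exp (⟪x, toLp 2 ((graphMat H)ᵀ *ᵥ t)⟫ * Complex.I) *
        Complex.exp (-(yPart t ⬝ᵥ R *ᵥ yPart t / 2 : ℝ)) := by
    intro x
    simp only [h1, Complex.ofReal_add, add_mul, Complex.exp_add, integral_const_mul]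
    rw [← charFun_apply, charFun_linGauss H hR, h2, inner_add_right, Complex.ofReal_add, add_mul,
      Complex.exp_add, mul_assoc]
  simp only [h4]
  rw [integral_mul_const, ← charFun_apply, charFun_multivariateGaussian hP, ← Complex.exp_add,
    inner_mulVec_comm, jointCov, add_mulVec, dotProduct_add, dotProduct_congruence_mulVec,
    dotProduct_congruence_mulVec, h3, real_inner_comm]
  congr 1
  push_cast
  ring

lemma map_obsLaw (ν : Measure (Vec (Fin m))) (H : Matrix (Fin p) (Fin m) ℝ)
    (R : Matrix (Fin p) (Fin p) ℝ) :
    (obsLaw ν H R).map (fun z => (xPart z, yPart z)) = ν ⊗ₘ linGauss H R := by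
  rw [obsLaw, Measure.map_map (by fun_prop) (by fun_prop)]
  exact Measure.map_id

lemma obsLaw_map_xPart (ν : Measure (Vec (Fin m))) [SFinite ν] (H : Matrix (Fin p) (Fin m) ℝ)
    (R : Matrix (Fin p) (Fin p) ℝ) : (obsLaw ν H R).map xPart = ν := by
  have h := congrArg (Measure.map Prod.fst) (map_obsLaw ν H R)
  rw [Measure.map_map (by fun_prop) (by fun_prop)] at h
  exact h.trans (Measure.fst_compProd ν _)

lemma eq_obsLaw_iff (ν : Measure (Pair m p)) (H : Matrix (Fin p) (Fin m) ℝ)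
    (R : Matrix (Fin p) (Fin p) ℝ) :
    ν.map (fun z => (xPart z, yPart z)) = ν.map xPart ⊗ₘ linGauss H R ↔
      ν = obsLaw (ν.map xPart) H R := by
  constructor
  · intro h
    rw [obsLaw, ← h, Measure.map_map (by fun_prop) (by fun_prop)]
    refine Eq.trans Measure.map_id.symm ?_
    congr 1
    ext z i
    rcases i with i | i <;> rfl
  · intro h
    conv_lhs => rw [h]
    rw [map_obsLaw]

lemma obsLaw_smul (c : ENNReal) (ν : Measure (Vec (Fin m))) [SFinite ν]
    (H : Matrix (Fin p) (Fin m) ℝ)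
    (R : Matrix (Fin p) (Fin p) ℝ) : obsLaw (c • ν) H R = c • obsLaw ν H R := by
  rw [obsLaw, Measure.compProd_smul_left, Measure.map_smul, obsLaw]

/-- The columns of `[1; H]` and `[0; 1]` together form an invertible square matrix, so `B` is
determined by its two products. The physics constrains the first; the second is the free parameter.
-/
lemma BMat_eq_iff {K : ℕ} (φ : Physics m p K) (F2 : ℕ → Fin K → Fin K → Matrix (Fin m) (Fin p) ℝ)
    (H2 : ℕ → Fin K → Fin K → Matrix (Fin p) (Fin p) ℝ) (k : ℕ) (r s : Fin K)
    (B : PairMatrix m p) :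
    B = φ.BMat F2 H2 k r s ↔
      B * graphMat (φ.H k r) = graphMat (φ.H (k + 1) s) * φ.F (k + 1) s ∧
        B * obsMat m p = fromRows (F2 (k + 1) r s) (H2 (k + 1) r s) := by
  obtain ⟨a, b, c, d, rfl⟩ : ∃ a b c d, B = fromBlocks a b c d :=
    ⟨_, _, _, _, (fromBlocks_toBlocks B).symm⟩
  simp only [Physics.BMat, graphMat, obsMat, fromBlocks_mul_fromRows, fromRows_mul, Matrix.mul_one,
    Matrix.mul_zero, Matrix.one_mul, zero_add, fromBlocks_inj, fromRows_ext_iff]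
  constructor
  · rintro ⟨rfl, rfl, rfl, rfl⟩
    simp
  · rintro ⟨⟨h1, h2⟩, rfl, rfl⟩
    exact ⟨by simp [← h1], rfl, by simp [← h2], rfl⟩

lemma obsMat_congruence (R : Matrix (Fin p) (Fin p) ℝ) :
    obsMat m p * R * (obsMat m p)ᵀ = fromBlocks 0 0 0 R := by
  rw [obsMat, transpose_fromRows, fromRows_mul, fromRows_mul_fromCols]
  simp

/-- `Σ` is the physical covariance of the new pair minus the share already supplied by the previous
observation noise through `[F²; H²]`. Symmetry of `Q` and `R` matches the off-diagonal blocks. -/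
lemma SigmaMat_add {K : ℕ} (φ : Physics m p K) (hφ : φ.Regular)
    (F2 : ℕ → Fin K → Fin K → Matrix (Fin m) (Fin p) ℝ)
    (H2 : ℕ → Fin K → Fin K → Matrix (Fin p) (Fin p) ℝ) (k : ℕ) (r s : Fin K) :
    fromRows (F2 (k + 1) r s) (H2 (k + 1) r s) * φ.R k r *
        (fromRows (F2 (k + 1) r s) (H2 (k + 1) r s))ᵀ + φ.SigmaMat F2 H2 k r s =
      jointCov (φ.Q (k + 1) s) (φ.H (k + 1) s) (φ.R (k + 1) s) := by
  have hQ : (φ.Q (k + 1) s)ᵀ = φ.Q (k + 1) s := (hφ.posDef_Q k s).isHermitian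
  have hR : (φ.R k r)ᵀ = φ.R k r := (hφ.posDef_R k r).isHermitian
  simp only [jointCov, obsMat_congruence, graphMat, transpose_fromRows, fromRows_mul, mul_fromCols,
    fromCols_fromRows_eq_fromBlocks, Physics.SigmaMat, Physics.Sigma11, Physics.Sigma21, Physics.Sigma22, fromBlocks_add,
    transpose_one, transpose_sub, transpose_mul, transpose_transpose, hQ, hR,
    Matrix.mul_one, Matrix.one_mul]
  simp only [Matrix.mul_assoc]
  congr 1 <;> abel

/-- For `t = (x, y)` with `y ≠ 0` the `R` term is positive. If `y = 0`, then `[1; H]ᵀ t = x ≠ 0` and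
the `P` term is positive. -/
lemma posDef_jointCov {P : Matrix (Fin m) (Fin m) ℝ} (hP : P.PosDef)
    (H : Matrix (Fin p) (Fin m) ℝ) {R : Matrix (Fin p) (Fin p) ℝ} (hR : R.PosDef) :
    (jointCov P H R).PosDef := by
  refine .of_dotProduct_mulVec_pos (posSemidef_jointCov hP.posSemidef H hR.posSemidef).isHermitian
    fun t ht => ?_
  rw [star_trivial, jointCov, add_mulVec, dotProduct_add, dotProduct_congruence_mulVec,
    dotProduct_congruence_mulVec]
  have h1 := hP.posSemidef.dotProduct_mulVec_nonneg ((graphMat H)ᵀ *ᵥ t)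
  have h2 := hR.posSemidef.dotProduct_mulVec_nonneg ((obsMat m p)ᵀ *ᵥ t)
  rw [star_trivial] at h1 h2
  have e1 : (graphMat H)ᵀ *ᵥ t = t ∘ Sum.inl + Hᵀ *ᵥ (t ∘ Sum.inr) := by
    simp [graphMat, transpose_fromRows, fromCols_mulVec]
  have e2 : (obsMat m p)ᵀ *ᵥ t = t ∘ Sum.inr := by
    simp [obsMat, transpose_fromRows, fromCols_mulVec]
  by_cases hy : t ∘ Sum.inr = 0
  · have hx : t ∘ Sum.inl ≠ 0 := by
      intro hx
      refine ht (funext fun i => ?_)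
      rcases i with i | i
      exacts [congrFun hx i, congrFun hy i]
    have h3 := hP.dotProduct_mulVec_pos hx
    rw [star_trivial] at h3
    rw [e1, hy, mulVec_zero, add_zero]
    exact add_pos_of_pos_of_nonneg h3 h2
  · have h3 := hR.dotProduct_mulVec_pos hy
    rw [star_trivial] at h3
    exact add_pos_of_nonneg_of_pos h1 (by rwa [e2])

variable {F Q : Matrix (Fin m) (Fin m) ℝ} {H H' : Matrix (Fin p) (Fin m) ℝ}
  {R R' : Matrix (Fin p) (Fin p) ℝ} {B S : PairMatrix m p}

/-- `B` acts on the two independent sources of `z` separately: the state part is carried along by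
`F`, and the observation noise passes through `B [0; 1]`. -/
lemma congruence_jointCov (hB : B * graphMat H = graphMat H' * F) (P : Matrix (Fin m) (Fin m) ℝ) :
    B * jointCov P H R * Bᵀ = graphMat H' * (F * P * Fᵀ) * (graphMat H')ᵀ +
      (B * obsMat m p) * R * (B * obsMat m p)ᵀ := by
  have : B * (graphMat H * P * (graphMat H)ᵀ) * Bᵀ =
      (B * graphMat H) * P * (B * graphMat H)ᵀ := by
    simp only [transpose_mul, Matrix.mul_assoc]
  rw [jointCov, Matrix.mul_add, Matrix.add_mul, this, hB]
  simp only [transpose_mul, Matrix.mul_assoc]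

lemma jointCov_add (P P' : Matrix (Fin m) (Fin m) ℝ) :
    jointCov (P + P') H R = graphMat H * P * (graphMat H)ᵀ + jointCov P' H R := by
  simp only [jointCov, Matrix.mul_add, Matrix.add_mul, add_assoc]

/-- The transition of the pair acts on the observation law of `δ_x` through the transition of the
state. -/
lemma linGauss_comp_obsLaw_dirac (hQ : Q.PosSemidef) (hR : R.PosSemidef) (hR' : R'.PosSemidef)
    (hS : S.PosSemidef) (hB : B * graphMat H = graphMat H' * F)
    (hS' : (B * obsMat m p) * R * (B * obsMat m p)ᵀ + S = jointCov Q H' R') (x : Vec (Fin m)) :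
    linGauss B S ∘ₘ obsLaw (Measure.dirac x) H R = obsLaw (linGauss F Q x) H' R' := by
  -- With zero covariance for `x`, the propagated covariance is just `G R Gᵀ + S`, which `hS'`
  -- identifies.
  rw [← multivariateGaussian_zero_cov, obsLaw_multivariateGaussian _ .zero _ hR,
    linGauss_comp_multivariateGaussian _ (posSemidef_jointCov .zero _ hR) hS, linGauss_apply,
    obsLaw_multivariateGaussian _ hQ _ hR', congruence_jointCov hB]
  simp only [mulVec_mulVec, hB, Matrix.mul_zero, Matrix.zero_mul, zero_add, hS']

/-- Disintegrate over the old state `x` and apply the Dirac case for each `x`. Keeping `x` in the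
test function gives the joint law of old and new states; forgetting it gives the law of the new
pair. -/
lemma lintegral_obsLaw_compProd (hQ : Q.PosSemidef) (hR : R.PosSemidef) (hR' : R'.PosSemidef)
    (hS : S.PosSemidef) (hB : B * graphMat H = graphMat H' * F)
    (hS' : (B * obsMat m p) * R * (B * obsMat m p)ᵀ + S = jointCov Q H' R')
    (ν : Measure (Vec (Fin m))) [SFinite ν] {f : Vec (Fin m) × Pair m p → ENNReal}
    (hf : Measurable f) :
    ∫⁻ q, f (xPart q.1, q.2) ∂(obsLaw ν H R ⊗ₘ linGauss B S) =
      ∫⁻ x, ∫⁻ z, f (x, z) ∂(obsLaw (linGauss F Q x) H' R') ∂ν := by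
  have hf' : Measurable fun q : Pair m p × Pair m p => f (xPart q.1, q.2) := by fun_prop
  have : SFinite (obsLaw ν H R) := by unfold obsLaw; infer_instance
  have hk : Measurable fun z : Pair m p => ∫⁻ z', f (xPart z, z') ∂(linGauss B S z) :=
    Measurable.lintegral_kernel_prod_right' hf'
  rw [Measure.lintegral_compProd hf']
  unfold obsLaw
  rw [lintegral_map hk measurable_joinXY, Measure.lintegral_compProd (by exact hk.comp measurable_joinXY)]
  refine lintegral_congr fun x => ?_
  change _ = ∫⁻ z, f (x, z) ∂(obsLaw (linGauss F Q x) H' R')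
  rw [← linGauss_comp_obsLaw_dirac hQ hR hR' hS hB hS' x,
    Measure.lintegral_bind (by fun_prop) (by fun_prop)]
  unfold obsLaw
  have hk' : Measurable fun z : Pair m p => ∫⁻ z', f (x, z') ∂(linGauss B S z) :=
    Measurable.lintegral_kernel (by fun_prop)
  rw [lintegral_map hk' measurable_joinXY, Measure.lintegral_compProd (by fun_prop),
    lintegral_dirac' _ (by
      exact Measurable.lintegral_kernel_prod_right' (hk'.comp measurable_joinXY))]
  rfl

lemma map_xPart_obsLaw_compProd (hQ : Q.PosSemidef) (hR : R.PosSemidef) (hR' : R'.PosSemidef)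
    (hS : S.PosSemidef) (hB : B * graphMat H = graphMat H' * F)
    (hS' : (B * obsMat m p) * R * (B * obsMat m p)ᵀ + S = jointCov Q H' R')
    (ν : Measure (Vec (Fin m))) [SFinite ν] :
    (obsLaw ν H R ⊗ₘ linGauss B S).map (fun q => (xPart q.1, xPart q.2)) =
      ν ⊗ₘ linGauss F Q := by
  refine Measure.ext_of_lintegral _ fun f hf => ?_
  rw [lintegral_map hf (by fun_prop), Measure.lintegral_compProd hf]
  have hf' : Measurable fun q : Vec (Fin m) × Pair m p => f (q.1, xPart q.2) := by fun_prop
  rw [lintegral_obsLaw_compProd hQ hR hR' hS hB hS' ν hf']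
  refine lintegral_congr fun x => ?_
  rw [← obsLaw_map_xPart (linGauss F Q x) H' R', lintegral_map (by fun_prop) measurable_xPart,
    obsLaw_map_xPart]

lemma linGauss_comp_obsLaw (hQ : Q.PosSemidef) (hR : R.PosSemidef) (hR' : R'.PosSemidef)
    (hS : S.PosSemidef) (hB : B * graphMat H = graphMat H' * F)
    (hS' : (B * obsMat m p) * R * (B * obsMat m p)ᵀ + S = jointCov Q H' R')
    (ν : Measure (Vec (Fin m))) [SFinite ν] :
    linGauss B S ∘ₘ obsLaw ν H R = obsLaw (linGauss F Q ∘ₘ ν) H' R' := by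
  have : SFinite (obsLaw ν H R) := by unfold obsLaw; infer_instance
  refine Measure.ext_of_lintegral _ fun f hf => ?_
  have h := lintegral_obsLaw_compProd hQ hR hR' hS hB hS' ν (f := fun q => f q.2) (by fun_prop)
  rw [← Measure.snd_compProd, Measure.snd, lintegral_map hf measurable_snd, h]
  unfold obsLaw
  have hg : Measurable fun q => f (joinXY (m := m) (p := p) q) := by fun_prop
  rw [lintegral_map hf measurable_joinXY, Measure.lintegral_compProd hg,
    Measure.lintegral_bind (by fun_prop)
      (Measurable.lintegral_kernel_prod_right' hg).aemeasurable]
  refine lintegral_congr fun x => ?_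
  rw [lintegral_map hf measurable_joinXY, Measure.lintegral_compProd hg]

/-- If the transition of the pair is compatible with the transition of the state for Gaussian
states of arbitrary mean, then its matrices are determined by their action on the noise of the
previous observation. -/
lemma matrices_of_linGauss_comp_obsLaw {P : Matrix (Fin m) (Fin m) ℝ} (hP : P.PosSemidef)
    (hQ : Q.PosSemidef) (hR : R.PosSemidef) (hR' : R'.PosSemidef) (hS : S.PosSemidef)
    (h : ∀ u, linGauss B S ∘ₘ obsLaw (multivariateGaussian u P) H R =
      obsLaw (linGauss F Q ∘ₘ multivariateGaussian u P) H' R') :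
    B * graphMat H = graphMat H' * F ∧
      (B * obsMat m p) * R * (B * obsMat m p)ᵀ + S = jointCov Q H' R' := by
  have hP' : (F * P * Fᵀ + Q).PosSemidef := (hP.mul_mul_conjTranspose_same F).add hQ
  have hJ := posSemidef_jointCov hP H hR
  have key : ∀ u : Vec (Fin m), (B * graphMat H) *ᵥ u = (graphMat H' * F) *ᵥ u ∧
      B * jointCov P H R * Bᵀ + S = jointCov (F * P * Fᵀ + Q) H' R' := by
    intro u
    have h1 := h u
    rw [obsLaw_multivariateGaussian _ hP _ hR, linGauss_comp_multivariateGaussian _ hJ hS,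
      linGauss_comp_multivariateGaussian _ hP hQ, obsLaw_multivariateGaussian _ hP' _ hR'] at h1
    obtain ⟨h2, h3⟩ := multivariateGaussian_injective
      ((hJ.mul_mul_conjTranspose_same B).add hS) (posSemidef_jointCov hP' _ hR') h1
    refine ⟨?_, h3⟩
    have := congrArg ofLp h2
    simpa [mulVec_mulVec] using this
  have hB : B * graphMat H = graphMat H' * F :=
    -- Arbitrary means enter here: equality of the mean vectors is tested on the standard basis.
    ext_of_mulVec_single fun i => (key (toLp 2 (Pi.single i 1))).1
  refine ⟨hB, ?_⟩
  -- The covariance equation does not involve `u`. Given `hB`, both sides contain the contribution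
  -- of `F P Fᵀ`, which cancels and leaves the identity free of `P`.
  have h3 := (key 0).2
  rw [congruence_jointCov hB, jointCov_add, add_assoc] at h3
  exact add_left_cancel h3

end Joint

/-! ### Physical properties versus matrix conditions -/

section Equivalence

open Matrix WithLp

variable {m p K : ℕ} {φ : Physics m p K} {m0 : Fin K → Vec (Fin m)}

/-- The physical state property, path by path. -/
lemma state_iff (μ : Measure (ℕ → Obs m p K)) [IsProbabilityMeasure μ] (k : ℕ) :
    HasCondDistrib (xAt (k + 1)) (fun ω => (xAt k ω, rUpTo (k + 1) ω))
        (givenPath (k + 1) (gaussKernel (φ.F (k + 1)) (φ.Q (k + 1)))) μ ↔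
      ∀ ρ, (μ.restrict (rUpTo (k + 1) ⁻¹' {ρ})).map (fun ω => (xAt k ω, xAt (k + 1) ω)) =
        (μ.restrict (rUpTo (k + 1) ⁻¹' {ρ})).map (xAt k) ⊗ₘ
          linGauss (φ.F (k + 1) (pathLast ρ)) (φ.Q (k + 1) (pathLast ρ)) := by
  have : IsMarkovKernel (givenPath (k + 1) (gaussKernel (φ.F (k + 1)) (φ.Q (k + 1)))) := by
    unfold givenPath; infer_instance
  exact hasCondDistrib_prod_iff (measurable_xAt k) (measurable_rUpTo (k + 1))
    (measurable_xAt (k + 1)) _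

/-- The physical likelihood property, path by path. -/
lemma likelihood_iff (μ : Measure (ℕ → Obs m p K)) [IsProbabilityMeasure μ] (k : ℕ) :
    HasCondDistrib (yAt k) (fun ω => (xAt k ω, rUpTo k ω))
        (givenPath k (gaussKernel (φ.H k) (φ.R k))) μ ↔
      ∀ ρ, (μ.restrict (rUpTo k ⁻¹' {ρ})).map (zAt k) =
        obsLaw ((μ.restrict (rUpTo k ⁻¹' {ρ})).map (xAt k))
          (φ.H k (pathLast ρ)) (φ.R k (pathLast ρ)) := by
  have : IsMarkovKernel (givenPath k (gaussKernel (φ.H k) (φ.R k))) := by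
    unfold givenPath; infer_instance
  refine (hasCondDistrib_prod_iff (measurable_xAt k) (measurable_rUpTo k)
    (measurable_yAt k) _).trans (forall_congr' fun ρ => ?_)
  have h := eq_obsLaw_iff ((μ.restrict (rUpTo k ⁻¹' {ρ})).map (zAt k))
    (φ.H k (pathLast ρ)) (φ.R k (pathLast ρ))
  rw [Measure.map_map (by fun_prop) (by fun_prop), Measure.map_map (by fun_prop) (by fun_prop)] at h
  exact h

variable {D : Dynamics m p K} {init : Fin K → ProbabilityMeasure (Pair m p)}

lemma map_zAt_of_fiber_succ (k : ℕ) (ρ : Finset.Iic (k + 1) → Fin K) :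
    ((D.law init).restrict (rUpTo (k + 1) ⁻¹' {ρ})).map (zAt k) =
      D.jump (k + 1) (pathLast (pathInit ρ)) (pathLast ρ) •
        ((D.law init).restrict (rUpTo k ⁻¹' {pathInit ρ})).map (zAt k) := by
  have h := congrArg (Measure.map Prod.fst) (law_fiber_succ D init k ρ)
  rw [Measure.map_map (by fun_prop) (by fun_prop), Measure.map_smul] at h
  exact h.trans (congrArg _ (Measure.fst_compProd _ _))

lemma map_zAt_succ_of_fiber_succ (k : ℕ) (ρ : Finset.Iic (k + 1) → Fin K) :
    ((D.law init).restrict (rUpTo (k + 1) ⁻¹' {ρ})).map (zAt (k + 1)) =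
      D.jump (k + 1) (pathLast (pathInit ρ)) (pathLast ρ) •
        (linGauss (D.B (k + 1) (pathLast (pathInit ρ)) (pathLast ρ))
            (D.S (k + 1) (pathLast (pathInit ρ)) (pathLast ρ)) ∘ₘ
          ((D.law init).restrict (rUpTo k ⁻¹' {pathInit ρ})).map (zAt k)) := by
  have h := congrArg (Measure.map Prod.snd) (law_fiber_succ D init k ρ)
  rw [Measure.map_map (by fun_prop) (by fun_prop), Measure.map_smul] at h
  exact h.trans (congrArg _ (Measure.snd_compProd _ _))

/-- With the physical properties, the law of the state along a path moves by the physical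
transition. -/
lemma HasPhysics.obsLaw_succ (h : HasPhysics φ m0 (D.law init)) {k : ℕ}
    (ρ : Finset.Iic (k + 1) → Fin K) {c : ENNReal} {ν : Measure (Vec (Fin m))} [SFinite ν]
    {H : Matrix (Fin p) (Fin m) ℝ} {R : Matrix (Fin p) (Fin p) ℝ}
    (hν : ((D.law init).restrict (rUpTo k ⁻¹' {pathInit ρ})).map (zAt k) = c • obsLaw ν H R) :
    ((D.law init).restrict (rUpTo (k + 1) ⁻¹' {ρ})).map (zAt (k + 1)) =
      (D.jump (k + 1) (pathLast (pathInit ρ)) (pathLast ρ) * c) •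
        obsLaw (linGauss (φ.F (k + 1) (pathLast ρ)) (φ.Q (k + 1) (pathLast ρ)) ∘ₘ ν)
          (φ.H (k + 1) (pathLast ρ)) (φ.R (k + 1) (pathLast ρ)) := by
  -- Jumps ignore `z_k`, so fixing the next regime only rescales the law of `x_k`.
  have h1 : ((D.law init).restrict (rUpTo (k + 1) ⁻¹' {ρ})).map (xAt k) =
      (D.jump (k + 1) (pathLast (pathInit ρ)) (pathLast ρ) * c) • ν := by
    have := congrArg (Measure.map xPart) (map_zAt_of_fiber_succ (D := D) (init := init) k ρ)
    rw [hν, smul_smul, Measure.map_map (by fun_prop) (by fun_prop), Measure.map_smul,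
      obsLaw_map_xPart] at this
    exact this
  have h2 := congrArg (Measure.map Prod.snd) ((state_iff _ k).1 (h.state k) ρ)
  rw [Measure.map_map (by fun_prop) (by fun_prop), h1] at h2
  have h3 : ((D.law init).restrict (rUpTo (k + 1) ⁻¹' {ρ})).map (xAt (k + 1)) = _ :=
    h2.trans (Measure.snd_compProd _ _)
  rw [(likelihood_iff _ (k + 1)).1 (h.likelihood (k + 1)) ρ, h3, Measure.comp_smul, obsLaw_smul]

lemma HasPhysics.jump_eq (h : HasPhysics φ m0 (D.law init)) (k : ℕ) (r : Fin K)
    (hr : D.jumpLaw k r ≠ 0) : D.jump (k + 1) r = φ.jump (k + 1) r := by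
  ext s
  have h1 := (hasCondDistrib_discrete_iff (measurable_rAt k) (measurable_rAt (k + 1)) _).1
    (h.jump k) r
  have h2 := congrArg (fun ν => ν {s}) h1
  have hs : MeasurableSet (rAt (m := m) (p := p) (K := K) (k + 1) ⁻¹' {s}) :=
    measurable_rAt _ (measurableSet_singleton s)
  beta_reduce at h2
  rw [Measure.map_apply (by fun_prop) (measurableSet_singleton s), Measure.restrict_apply hs,
    Set.inter_comm, law_rAt_succ_inter, Measure.smul_apply, smul_eq_mul, law_rAt] at h2
  have h3 : jumpKernel (φ.jump (k + 1)) r {s} = φ.jump (k + 1) r s :=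
    PMF.toMeasure_apply_singleton _ _ (measurableSet_singleton s)
  rw [h3] at h2
  exact (ENNReal.mul_right_inj hr (PMF.apply_ne_top _ _)).1 h2

lemma smul_measure_cancel {α : Type*} [MeasurableSpace α] {c : ENNReal} (h0 : c ≠ 0) (ht : c ≠ ⊤)
    {μ ν : Measure α} (h : c • μ = c • ν) : μ = ν := by
  ext s hs
  have h3 := congrArg (fun ν => ν s) h
  simp only [Measure.smul_apply, smul_eq_mul] at h3
  exact (ENNReal.mul_right_inj h0 ht).1 h3

lemma HasPhysics.init_eq (h : HasPhysics φ m0 (D.law init)) (r : Fin K)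
    (hr : D.jumpInit r ≠ 0) :
    (init r : Measure (Pair m p)) = obsLaw (multivariateGaussian (m0 r) (φ.P0 r)) (φ.H 0 r)
      (φ.R 0 r) := by
  have : IsMarkovKernel (Kernel.ofFunOfCountable fun r => multivariateGaussian (m0 r) (φ.P0 r)) :=
    ⟨fun r => by change IsProbabilityMeasure (multivariateGaussian _ _); infer_instance⟩
  have h1 := (hasCondDistrib_discrete_iff (measurable_rAt 0) (measurable_xAt 0) _).1 h.initial r
  have h2 := (likelihood_iff _ 0).1 (h.likelihood 0) (fun _ => r)
  rw [rUpTo_zero_preimage] at h2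
  change ((D.law init).restrict (rAt 0 ⁻¹' {r})).map (zAt 0) =
    obsLaw (((D.law init).restrict (rAt 0 ⁻¹' {r})).map (xAt 0)) (φ.H 0 r) (φ.R 0 r) at h2
  rw [h1, law_rAt, law_fiber_zAt_zero] at h2
  change D.jumpInit r • _ = obsLaw (D.jumpInit r • multivariateGaussian (m0 r) (φ.P0 r)) _ _ at h2
  rw [obsLaw_smul] at h2
  exact smul_measure_cancel hr (PMF.apply_ne_top _ _) h2

variable {ini : (Fin K → Vec (Fin m)) → Fin K → ProbabilityMeasure (Pair m p)}

lemma jumpLaw_succ_ne_zero {k : ℕ} {s : Fin K} :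
    D.jumpLaw (k + 1) s ≠ 0 ↔ ∃ r, D.jumpLaw k r ≠ 0 ∧ D.jump (k + 1) r s ≠ 0 := by
  rw [← PMF.mem_support_iff, Dynamics.jumpLaw, PMF.mem_support_bind_iff]
  rfl

/-- Every regime of positive probability ends a path along which the state is Gaussian, with a mean
that is an invertible function of the prior mean. -/
lemma exists_path_gaussian (hφ : φ.Regular) (h : ∀ m0, HasPhysics φ m0 (D.law (ini m0)))
    (k : ℕ) (r : Fin K) (hr : D.jumpLaw k r ≠ 0) :
    ∃ ρ : Finset.Iic k → Fin K, pathLast ρ = r ∧ ∃ (r0 : Fin K) (M P : Matrix (Fin m) (Fin m) ℝ)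
      (c : ENNReal), IsUnit M ∧ P.PosSemidef ∧ c ≠ 0 ∧ c ≠ ⊤ ∧
      ∀ m0, ((D.law (ini m0)).restrict (rUpTo k ⁻¹' {ρ})).map (zAt k) =
        c • obsLaw (multivariateGaussian (toLp 2 (M *ᵥ m0 r0)) P) (φ.H k r) (φ.R k r) := by
  induction k generalizing r with
  | zero =>
    refine ⟨fun _ => r, rfl, r, 1, φ.P0 r, D.jumpInit r, isUnit_one, (hφ.posDef_P0 r).posSemidef,
      hr, PMF.apply_ne_top _ _, fun m0 => ?_⟩
    rw [rUpTo_zero_preimage]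
    refine (law_fiber_zAt_zero D (ini m0) r).trans ?_
    rw [(h m0).init_eq r hr]
    simp
  | succ k ih =>
    obtain ⟨r', hr', hj⟩ := jumpLaw_succ_ne_zero.1 hr
    obtain ⟨ρ, hρ, r0, M, P, c, hM, hP, hc0, hct, hz⟩ := ih r' hr'
    have hQ := (hφ.posDef_Q k r).posSemidef
    -- Kalman prediction updates the mean matrix and the covariance. The path and all these
    -- constants are chosen before `m0`, so a single path serves every prior mean.
    refine ⟨pathSnoc ρ r, pathLast_pathSnoc ρ r, r0, φ.F (k + 1) r * M,
      φ.F (k + 1) r * P * (φ.F (k + 1) r)ᵀ + φ.Q (k + 1) r, D.jump (k + 1) r' r * c,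
      (hφ.isUnit_F k r).mul hM, (hP.mul_mul_conjTranspose_same (φ.F (k + 1) r)).add hQ,
      mul_ne_zero hj hc0, ENNReal.mul_ne_top (PMF.apply_ne_top _ _) hct, fun m0 => ?_⟩
    have h1 := (h m0).obsLaw_succ (pathSnoc ρ r) (by rw [pathInit_pathSnoc]; exact hz m0)
    rw [pathInit_pathSnoc, pathLast_pathSnoc, hρ, linGauss_comp_multivariateGaussian _ hP hQ] at h1
    simpa only [mulVec_mulVec] using h1

/-- Taking `m0` constant equal to `M⁻¹ u` gives `x_k` the mean `u` along the chosen path. After the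
jump to `s`, the model transition and the physical properties each express the law of `z_{k+1}`,
with the same nonzero finite weight. -/
lemma matrices_of_hasPhysics (hφ : φ.Regular) (h : ∀ m0, HasPhysics φ m0 (D.law (ini m0)))
    (k : ℕ) (r s : Fin K) (hr : D.jumpLaw k r ≠ 0) (hj : D.jump (k + 1) r s ≠ 0) :
    D.B (k + 1) r s * graphMat (φ.H k r) = graphMat (φ.H (k + 1) s) * φ.F (k + 1) s ∧
      (D.B (k + 1) r s * obsMat m p) * φ.R k r * (D.B (k + 1) r s * obsMat m p)ᵀ +
        D.S (k + 1) r s = jointCov (φ.Q (k + 1) s) (φ.H (k + 1) s) (φ.R (k + 1) s) := by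
  obtain ⟨ρ, hρ, r0, M, P, c, hM, hP, hc0, hct, hz⟩ := exists_path_gaussian hφ h k r hr
  refine matrices_of_linGauss_comp_obsLaw hP (hφ.posDef_Q k s).posSemidef
    (hφ.posDef_R k r).posSemidef (hφ.posDef_R (k + 1) s).posSemidef
    (D.posDef_S k r s).posSemidef fun u => ?_
  have hu : (toLp 2 (M *ᵥ (toLp 2 (M⁻¹ *ᵥ u) : Vec (Fin m))) : Vec (Fin m)) = u := by
    change toLp 2 (M *ᵥ (M⁻¹ *ᵥ u)) = u
    rw [mulVec_mulVec, mul_nonsing_inv _ ((isUnit_iff_isUnit_det M).1 hM), one_mulVec]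
  have hz' := hz fun _ => toLp 2 (M⁻¹ *ᵥ u)
  rw [hu] at hz'
  have h1 := (h fun _ => toLp 2 (M⁻¹ *ᵥ u)).obsLaw_succ (pathSnoc ρ s)
    (by rw [pathInit_pathSnoc]; exact hz')
  rw [map_zAt_succ_of_fiber_succ, pathInit_pathSnoc, pathLast_pathSnoc, hρ, hz',
    Measure.comp_smul, smul_smul] at h1
  exact smul_measure_cancel (mul_ne_zero hj hc0) (ENNReal.mul_ne_top (PMF.apply_ne_top _ _) hct) h1

lemma hasPhysics_initial (hinit : ∀ r, D.jumpInit r ≠ 0 →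
      (init r : Measure (Pair m p)) = obsLaw (multivariateGaussian (m0 r) (φ.P0 r)) (φ.H 0 r)
        (φ.R 0 r)) :
    HasCondDistrib (xAt 0) (rAt 0)
      (Kernel.ofFunOfCountable fun r => multivariateGaussian (m0 r) (φ.P0 r)) (D.law init) := by
  have : IsMarkovKernel (Kernel.ofFunOfCountable fun r => multivariateGaussian (m0 r) (φ.P0 r)) :=
    ⟨fun r => by change IsProbabilityMeasure (multivariateGaussian _ _); infer_instance⟩
  refine (hasCondDistrib_discrete_iff (measurable_rAt 0) (measurable_xAt 0) _).2 fun r => ?_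
  have h := congrArg (Measure.map xPart) (law_fiber_zAt_zero D init r)
  rw [Measure.map_map (by fun_prop) (by fun_prop), Measure.map_smul] at h
  refine h.trans ?_
  rw [law_rAt, Dynamics.jumpLaw]
  by_cases hr : D.jumpInit r = 0
  · simp [hr]
  · rw [hinit r hr, obsLaw_map_xPart]
    rfl

lemma hasPhysics_jump (hjump : ∀ k r, D.jumpLaw k r ≠ 0 → D.jump (k + 1) r = φ.jump (k + 1) r)
    (k : ℕ) :
    HasCondDistrib (rAt (k + 1)) (rAt k) (jumpKernel (φ.jump (k + 1))) (D.law init) := by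
  refine (hasCondDistrib_discrete_iff (measurable_rAt k) (measurable_rAt (k + 1)) _).2 fun r => ?_
  refine Measure.ext_of_singleton fun s => ?_
  have hs : MeasurableSet (rAt (m := m) (p := p) (K := K) (k + 1) ⁻¹' {s}) :=
    measurable_rAt _ (measurableSet_singleton s)
  have h3 : jumpKernel (φ.jump (k + 1)) r {s} = φ.jump (k + 1) r s :=
    PMF.toMeasure_apply_singleton _ _ (measurableSet_singleton s)
  rw [Measure.map_apply (by fun_prop) (measurableSet_singleton s), Measure.restrict_apply hs,
    Set.inter_comm, law_rAt_succ_inter, Measure.smul_apply, smul_eq_mul, law_rAt, h3]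
  by_cases hr : D.jumpLaw k r = 0
  · simp [hr]
  · rw [hjump k r hr]

lemma law_fiber_eq_zero {k : ℕ} {ρ : Finset.Iic k → Fin K} (h : D.jumpLaw k (pathLast ρ) = 0) :
    (D.law init).restrict (rUpTo k ⁻¹' {ρ}) = 0 := by
  rw [Measure.restrict_eq_zero]
  refine measure_mono_null ?_ ((law_rAt D init k (pathLast ρ)).trans h)
  rintro ω rfl
  rfl

/-- The hypotheses on the initial laws and on the transitions of the pair, in a coordinate-free
form. -/
structure Compatible (φ : Physics m p K) (m0 : Fin K → Vec (Fin m)) (D : Dynamics m p K)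
    (init : Fin K → ProbabilityMeasure (Pair m p)) : Prop where
  init_eq : ∀ r, D.jumpInit r ≠ 0 → (init r : Measure (Pair m p)) =
    obsLaw (multivariateGaussian (m0 r) (φ.P0 r)) (φ.H 0 r) (φ.R 0 r)
  mul_graphMat : ∀ k r s, D.jumpLaw k r ≠ 0 → D.jump (k + 1) r s ≠ 0 →
    D.B (k + 1) r s * graphMat (φ.H k r) = graphMat (φ.H (k + 1) s) * φ.F (k + 1) s
  cov_eq : ∀ k r s, D.jumpLaw k r ≠ 0 → D.jump (k + 1) r s ≠ 0 →
    (D.B (k + 1) r s * obsMat m p) * φ.R k r * (D.B (k + 1) r s * obsMat m p)ᵀ +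
      D.S (k + 1) r s = jointCov (φ.Q (k + 1) s) (φ.H (k + 1) s) (φ.R (k + 1) s)

/-- Induction on time: the transition preserves the shape `obsLaw ν H R`, whatever `ν` is. -/
lemma Compatible.law_fiber_eq_obsLaw (h : Compatible φ m0 D init) (hφ : φ.Regular) (k : ℕ)
    (ρ : Finset.Iic k → Fin K) :
    ((D.law init).restrict (rUpTo k ⁻¹' {ρ})).map (zAt k) =
      obsLaw (((D.law init).restrict (rUpTo k ⁻¹' {ρ})).map (xAt k))
        (φ.H k (pathLast ρ)) (φ.R k (pathLast ρ)) := by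
  by_cases hr : D.jumpLaw k (pathLast ρ) = 0
  · simp [law_fiber_eq_zero hr, obsLaw]
  -- Any such `ν` is automatically the state marginal, so it need not be tracked through the
  -- induction.
  suffices ∃ ν : Measure (Vec (Fin m)), SFinite ν ∧
      ((D.law init).restrict (rUpTo k ⁻¹' {ρ})).map (zAt k) =
        obsLaw ν (φ.H k (pathLast ρ)) (φ.R k (pathLast ρ)) by
    obtain ⟨ν, _, hν⟩ := this
    have h1 := congrArg (Measure.map xPart) hν
    rw [obsLaw_map_xPart, Measure.map_map (by fun_prop) (by fun_prop)] at h1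
    rw [hν, ← h1]
    rfl
  induction k with
  | zero =>
    refine ⟨D.jumpInit (pathLast ρ) •
      multivariateGaussian (m0 (pathLast ρ)) (φ.P0 (pathLast ρ)), inferInstance, ?_⟩
    rw [rUpTo_zero_preimage, law_fiber_zAt_zero, h.init_eq _ hr, obsLaw_smul]
  | succ k ih =>
    rw [map_zAt_succ_of_fiber_succ]
    set r := pathLast (pathInit ρ)
    set s := pathLast ρ
    -- A path can be null although its last regime has positive probability. The matrix identities
    -- are then unavailable, but `ν = 0` works.
    by_cases hr' : D.jumpLaw k r = 0
    · exact ⟨0, inferInstance, by simp [law_fiber_eq_zero hr', obsLaw]⟩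
    by_cases hj : D.jump (k + 1) r s = 0
    · exact ⟨0, inferInstance, by simp [hj, obsLaw]⟩
    obtain ⟨ν, _, hν⟩ := ih (pathInit ρ) hr'
    refine ⟨D.jump (k + 1) r s • (linGauss (φ.F (k + 1) s) (φ.Q (k + 1) s) ∘ₘ ν), inferInstance, ?_⟩
    rw [hν, linGauss_comp_obsLaw (hφ.posDef_Q k s).posSemidef (hφ.posDef_R k r).posSemidef
      (hφ.posDef_R (k + 1) s).posSemidef (D.posDef_S k r s).posSemidef
      (h.mul_graphMat k r s hr' hj) (h.cov_eq k r s hr' hj), obsLaw_smul]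

lemma Compatible.hasPhysics (h : Compatible φ m0 D init) (hφ : φ.Regular)
    (hjump : ∀ k r, D.jumpLaw k r ≠ 0 → D.jump (k + 1) r = φ.jump (k + 1) r) :
    HasPhysics φ m0 (D.law init) where
  initial := hasPhysics_initial h.init_eq
  jump := hasPhysics_jump hjump
  likelihood k := (likelihood_iff _ k).2 (h.law_fiber_eq_obsLaw hφ k)
  state k := by
    refine (state_iff _ k).2 fun ρ => ?_
    have h1 : ((D.law init).restrict (rUpTo (k + 1) ⁻¹' {ρ})).map (xAt k) =
        D.jump (k + 1) (pathLast (pathInit ρ)) (pathLast ρ) •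
          ((D.law init).restrict (rUpTo k ⁻¹' {pathInit ρ})).map (xAt k) := by
      have := congrArg (Measure.map xPart) (map_zAt_of_fiber_succ (D := D) (init := init) k ρ)
      rw [Measure.map_map (by fun_prop) (by fun_prop), Measure.map_smul,
        Measure.map_map (by fun_prop) (by fun_prop)] at this
      exact this
    have h2 := congrArg (Measure.map fun q => (xPart q.1, xPart q.2)) (law_fiber_succ D init k ρ)
    rw [Measure.map_map (by fun_prop) (by fun_prop), Measure.map_smul] at h2
    refine Eq.trans h2 ?_
    rw [h1, Measure.compProd_smul_left]
    set r := pathLast (pathInit ρ)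
    set s := pathLast ρ
    by_cases hr : D.jumpLaw k r = 0
    · simp [law_fiber_eq_zero hr]
    by_cases hj : D.jump (k + 1) r s = 0
    · simp [hj]
    -- The state transition depends on the likelihood at time `k`: it is the law of `y_k` given
    -- `x_k` that must be averaged out of the pair transition.
    rw [h.law_fiber_eq_obsLaw hφ k, map_xPart_obsLaw_compProd (hφ.posDef_Q k s).posSemidef
      (hφ.posDef_R k r).posSemidef (hφ.posDef_R (k + 1) s).posSemidef
      (D.posDef_S k r s).posSemidef (h.mul_graphMat k r s hr hj) (h.cov_eq k r s hr hj)]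

/-- The last clause only names the blocks of `B [0; 1]`, so the displayed form amounts to the two
identities, in which `F2` and `H2` do not appear. -/
lemma matrices_eq_iff (hφ : φ.Regular) (F2 : ℕ → Fin K → Fin K → Matrix (Fin m) (Fin p) ℝ)
    (H2 : ℕ → Fin K → Fin K → Matrix (Fin p) (Fin p) ℝ) (k : ℕ) (r s : Fin K)
    (B S : PairMatrix m p) :
    B = φ.BMat F2 H2 k r s ∧ S = φ.SigmaMat F2 H2 k r s ↔
      (B * graphMat (φ.H k r) = graphMat (φ.H (k + 1) s) * φ.F (k + 1) s ∧
        (B * obsMat m p) * φ.R k r * (B * obsMat m p)ᵀ + S =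
          jointCov (φ.Q (k + 1) s) (φ.H (k + 1) s) (φ.R (k + 1) s)) ∧
      B * obsMat m p = fromRows (F2 (k + 1) r s) (H2 (k + 1) r s) := by
  rw [BMat_eq_iff, ← SigmaMat_add φ hφ F2 H2]
  constructor
  · rintro ⟨⟨h1, h2⟩, rfl⟩
    exact ⟨⟨h1, by rw [h2]⟩, h2⟩
  · rintro ⟨⟨h1, h3⟩, h2⟩
    rw [h2] at h3
    exact ⟨⟨h1, h2⟩, add_left_cancel h3⟩

lemma exists_matrices (hφ : φ.Regular)
    (h : ∀ k r s, D.jumpLaw k r ≠ 0 → D.jump (k + 1) r s ≠ 0 →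
      D.B (k + 1) r s * graphMat (φ.H k r) = graphMat (φ.H (k + 1) s) * φ.F (k + 1) s ∧
      (D.B (k + 1) r s * obsMat m p) * φ.R k r * (D.B (k + 1) r s * obsMat m p)ᵀ +
        D.S (k + 1) r s = jointCov (φ.Q (k + 1) s) (φ.H (k + 1) s) (φ.R (k + 1) s)) :
    ∃ (F2 : ℕ → Fin K → Fin K → Matrix (Fin m) (Fin p) ℝ)
      (H2 : ℕ → Fin K → Fin K → Matrix (Fin p) (Fin p) ℝ),
      (∀ k r s, (φ.SigmaMat F2 H2 k r s).PosDef) ∧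
      ∀ k r s, D.jumpLaw k r ≠ 0 → D.jump (k + 1) r s ≠ 0 →
        D.B (k + 1) r s = φ.BMat F2 H2 k r s ∧ D.S (k + 1) r s = φ.SigmaMat F2 H2 k r s := by
  classical
  let G : ℕ → Fin K → Fin K → Matrix (Fin m ⊕ Fin p) (Fin p) ℝ := fun k r s =>
    -- The index `k` is the arrival time, hence the regime law at `k - 1`; only `k ≥ 1` matters. On
    -- null transitions the value 0 is chosen to keep `Σ` positive definite.
    if D.jumpLaw (k - 1) r ≠ 0 ∧ D.jump k r s ≠ 0 then D.B k r s * obsMat m p else 0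
  let F2 : ℕ → Fin K → Fin K → Matrix (Fin m) (Fin p) ℝ := fun k r s => (G k r s).toRows₁
  let H2 : ℕ → Fin K → Fin K → Matrix (Fin p) (Fin p) ℝ := fun k r s => (G k r s).toRows₂
  have hG : ∀ k r s, fromRows (F2 k r s) (H2 k r s) = G k r s := fun k r s => fromRows_toRows _
  have hpos : ∀ k r s, D.jumpLaw k r ≠ 0 → D.jump (k + 1) r s ≠ 0 →
      D.B (k + 1) r s = φ.BMat F2 H2 k r s ∧ D.S (k + 1) r s = φ.SigmaMat F2 H2 k r s := by
    intro k r s hr hj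
    refine (matrices_eq_iff hφ F2 H2 k r s _ _).2 ⟨h k r s hr hj, ?_⟩
    rw [hG]
    exact (if_pos ⟨hr, hj⟩).symm
  refine ⟨F2, H2, fun k r s => ?_, hpos⟩
  by_cases hc : D.jumpLaw k r ≠ 0 ∧ D.jump (k + 1) r s ≠ 0
  · rw [← (hpos k r s hc.1 hc.2).2]
    exact D.posDef_S k r s
  · have h0 : G (k + 1) r s = 0 := if_neg hc
    -- With `F² = H² = 0`, `Σ` is the full physical covariance `jointCov Q H R`.
    have h1 := SigmaMat_add φ hφ F2 H2 k r s
    rw [hG, h0, Matrix.zero_mul, Matrix.zero_mul, zero_add] at h1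
    rw [h1]
    exact posDef_jointCov (hφ.posDef_Q k s) _ (hφ.posDef_R (k + 1) s)

end Equivalence

end CondPMC

end

theorem mainTheorem2 {m p K : ℕ} (φ : CondPMC.Physics m p K) (hφ : φ.Regular)
    (D : CondPMC.Dynamics m p K)
    (init : (Fin K → CondPMC.Vec (Fin m)) → Fin K → ProbabilityMeasure (CondPMC.Pair m p)) :
    (∀ m0 : Fin K → CondPMC.Vec (Fin m), CondPMC.HasPhysics φ m0 (D.law (init m0))) ↔
      (∀ k r, D.jumpLaw k r ≠ 0 → D.jump (k + 1) r = φ.jump (k + 1) r) ∧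
      (∀ m0 r, D.jumpInit r ≠ 0 →
        (init m0 r : Measure (CondPMC.Pair m p)) = φ.initialLaw m0 r) ∧
      ∃ (F2 : ℕ → Fin K → Fin K → Matrix (Fin m) (Fin p) ℝ)
        (H2 : ℕ → Fin K → Fin K → Matrix (Fin p) (Fin p) ℝ),
        (∀ k r s, (φ.SigmaMat F2 H2 k r s).PosDef) ∧
        ∀ k r s, D.jumpLaw k r ≠ 0 → D.jump (k + 1) r s ≠ 0 →
          D.B (k + 1) r s = φ.BMat F2 H2 k r s ∧
          D.S (k + 1) r s = φ.SigmaMat F2 H2 k r s := by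
  constructor
  · intro h
    -- The jumps do not depend on `m0`, so one prior mean suffices for them; `φ.initialLaw` is by
    -- definition the `obsLaw` of `init_eq`.
    exact ⟨(h 0).jump_eq, fun m0 r hr => (h m0).init_eq r hr,
      CondPMC.exists_matrices hφ (CondPMC.matrices_of_hasPhysics hφ h)⟩
  · rintro ⟨hjump, hinit, F2, H2, -, hmat⟩ m0
    have hm := fun k r s hr hj =>
      ((CondPMC.matrices_eq_iff hφ F2 H2 k r s _ _).1 (hmat k r s hr hj)).1
    exact CondPMC.Compatible.hasPhysics
      ⟨hinit m0, fun k r s hr hj => (hm k r s hr hj).1, fun k r s hr hj => (hm k r s hr hj).2⟩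
      hφ hjump
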